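/- **Setting.** Let $\mu$ be a probability measure on a measurable space $\mathcal T$ of individual characteristics $\theta$. Products $j=1,\dots,J$ have unit costs $c_j\ge 0$, and product $j$ is offered by firm $f(j)\in\{1,\dots,F\}$. Let $w_j:\mathcal T\times[0,\infty)\to[-\infty,\infty)$, $v_j:\mathcal T\to\mathbb R$, $\vartheta:\mathcal T\to\mathbb R$ and $\varsigma:\mathcal T\to(0,\infty]$ be measurable in $\theta$. Put $u_j(\theta,p)=w_j(\theta,p)+v_j(\theta)$, $e^{-\infty}=0$, and $$P^L_j(\theta,p)=\frac{e^{u_j(\theta,p_j)}}{e^{\vartheta(\theta)}+\sum_{k=1}^J e^{u_k(\theta,p_k)}},\qquad P_j(p)=\int P^L_j(\theta,p)\,d\mu(\theta),\qquad \hat\pi_f(p)=\sum_{j:\,f(j)=f}P_j(p)(p_j-c_j).$$ Let $\varsigma_*=\operatorname{ess\,sup}_\mu\varsigma$, and let $Dw_j$ denote the derivative of $w_j$ in the price. **Utility assumption.** For all $j$ and $\mu$-a.e. $\theta$: $w_j(\theta,\cdot)$ is finite, continuously differentiable and strictly decreasing on $(0,\varsigma(\theta))$; $w_j(\theta,p)=-\infty$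 for all $p\ge\varsigma(\theta)$; and $w_j(\theta,p)\to-\infty$ as $p\uparrow\varsigma(\theta)$. **Leibniz assumption.** For each $k$ let $\psi_k(\theta,p)=|Dw_k(\theta,p)|\,\dfrac{e^{u_k(\theta,p)}}{e^{\vartheta(\theta)}+e^{u_k(\theta,p)}}$ if $p<\varsigma(\theta)$, and $\psi_k(\theta,p)=0$ otherwise. For $\mu$-a.e. $\theta$, $\psi_k(\theta,\cdot)$ is continuous on $(0,\varsigma_*)$; and for each $p\in(0,\varsigma_*)$ there is a $\mu$-integrable $\varphi\ge0$ with $\psi_k(\cdot,p')\le\varphi$ $\mu$-a.e. for all $p'$ in some neighbourhood of $p$. **Boundedness assumption.** For $p\in(0,\infty)^J$ let $\Lambda(p)$ be the diagonal matrix with entries $\lambda_j(p)=\int_{\{\varsigma>p_j\}}Dw_j(\theta,p_j)P^L_j(\theta,p)\,d\mu(\theta)$, let $\tilde\Gamma(p)$ be the matrix with entries $\int_{\{\varsigma>p_j\}\cap\{\varsigma>p_k\}}P^L_j(\theta,p)P^L_k(\theta,p)Dw_k(\theta,p_k)\,d\mu(\theta)$ if $f(j)=f(k)$ and $0$ otherwise,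 and let $\tilde\Omega(p)=\Lambda(p)^{-1}\tilde\Gamma(p)^\top$. Then $\varsigma_*=\infty$, and there are $M>0$ and $\varepsilon\in(0,1)$ such that $$\sup_{p\in(0,\infty)^J}\|\Lambda(p)^{-1}P(p)\|_\infty\le M,\qquad \sup_{p\in(0,\infty)^J}\|\tilde\Omega(p)\|_\infty=1-\varepsilon ,$$ where the norm of a matrix is the one induced by the sup norm on vectors. **Claim (existence of finite simultaneously stationary prices).** Under these three assumptions there is a vector of finite prices $p\in(0,\infty)^J$ that is simultaneously stationary: $P$ is differentiable at $p$ and $\partial\hat\pi_{f(j)}/\partial p_j(p)=0$ for every $j$. Moreover, the matrix $\tilde DP(p)$ with entries $\partial P_j/\partial p_k(p)$ if $f(j)=f(k)$, and $0$ otherwise, is nonsingular, and $p$ is a fixed point of the markup equation $$p=c+\eta(p),\qquad \eta(p)=-\big(\tilde DP(p)^\top\big)^{-1}P(p).$$ -/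

import Mathlib

open Filter Topology MeasureTheory
open scoped ENNReal Matrix

/-- The data of a differentiated-product market with Mixed Logit demand:
`J` products offered by `F` firms to a population of individuals whose characteristics
`θ : T` are distributed according to the probability measure `μ`. -/
structure MixedLogitMarket (T : Type*) [MeasurableSpace T] (J F : ℕ) where
  /-- distribution of individual characteristics -/
  μ : Measure T
  isProbabilityMeasure : IsProbabilityMeasure μ
  /-- `firm j` is the firm that offers product `j` -/
  firm : Fin J → Fin F
  /-- unit costs -/
  cost : Fin J → ℝ
  cost_nonneg : ∀ j, 0 ≤ cost j
  /-- price component of utility, with values in `[-∞, ∞)` (only prices `p ≥ 0` matter) -/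
  w : Fin J → T → ℝ → EReal
  w_ne_top : ∀ j θ p, w j θ p ≠ ⊤
  w_measurable : ∀ j p, Measurable fun θ => w j θ p
  /-- non-price component of utility -/
  v : Fin J → T → ℝ
  v_measurable : ∀ j, Measurable (v j)
  /-- valuation of the outside good -/
  outside : T → ℝ
  outside_measurable : Measurable outside
  /-- individual reservation price, with values in `(0, ∞]` -/
  reservation : T → ℝ≥0∞
  reservation_pos : ∀ θ, 0 < reservation θ
  reservation_measurable : Measurable reservation

namespace MixedLogitMarket

variable {T : Type*} [MeasurableSpace T] {J F : ℕ}

/-- Systematic utility `u_j(θ, p) = w_j(θ, p) + v_j(θ)`. -/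
noncomputable def utility (m : MixedLogitMarket T J F) (j : Fin J) (θ : T) (p : ℝ) : EReal :=
  m.w j θ p + (m.v j θ : EReal)

/-- `e^{u_j(θ, p)}`, with `e^{-∞} = 0`. -/
noncomputable def expUtility (m : MixedLogitMarket T J F) (j : Fin J) (θ : T) (p : ℝ) : ℝ :=
  (EReal.exp (m.utility j θ p)).toReal

/-- Logit choice probabilities of an individual with characteristics `θ`. -/
noncomputable def logitProb (m : MixedLogitMarket T J F) (j : Fin J) (θ : T) (p : Fin J → ℝ) : ℝ :=
  m.expUtility j θ (p j) / (Real.exp (m.outside θ) + ∑ k, m.expUtility k θ (p k))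

/-- Mixed Logit choice probabilities. -/
noncomputable def prob (m : MixedLogitMarket T J F) (p : Fin J → ℝ) (j : Fin J) : ℝ :=
  ∫ θ, m.logitProb j θ p ∂m.μ

/-- The essential supremum of the reservation price. -/
noncomputable def maxReservation (m : MixedLogitMarket T J F) : ℝ≥0∞ :=
  essSup m.reservation m.μ

/-- The prices in the open interval `(0, s)`, where `s ∈ [0, ∞]`. -/
def pricesBelow (s : ℝ≥0∞) : Set ℝ := {t | 0 < t ∧ ENNReal.ofReal t < s}

/-- The derivative of `w_j(θ, ·)`; it is only used at prices in `(0, reservation θ)`, where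
`w_j(θ, ·)` is finite. -/
noncomputable def dw (m : MixedLogitMarket T J F) (j : Fin J) (θ : T) (p : ℝ) : ℝ :=
  deriv (fun t => (m.w j θ t).toReal) p

/-- The standing assumption on utilities: for every product and almost every individual, `w_j(θ, ·)`
is finite, continuously differentiable and strictly decreasing below the reservation price, it is
`-∞` from the reservation price on, and it tends to `-∞` as the price increases to the
reservation price. -/
structure UtilityAssumption (m : MixedLogitMarket T J F) : Prop where
  finite : ∀ j, ∀ᵐ θ ∂m.μ, ∀ t ∈ pricesBelow (m.reservation θ), m.w j θ t ≠ ⊥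
  contDiffOn : ∀ j, ∀ᵐ θ ∂m.μ,
    ContDiffOn ℝ 1 (fun t => (m.w j θ t).toReal) (pricesBelow (m.reservation θ))
  strictAntiOn : ∀ j, ∀ᵐ θ ∂m.μ, StrictAntiOn (m.w j θ) (pricesBelow (m.reservation θ))
  eq_bot : ∀ j, ∀ᵐ θ ∂m.μ, ∀ t : ℝ, 0 ≤ t → m.reservation θ ≤ ENNReal.ofReal t → m.w j θ t = ⊥
  tendsto_of_eq_top : ∀ j, ∀ᵐ θ ∂m.μ, m.reservation θ = ⊤ → Tendsto (m.w j θ) atTop (𝓝 ⊥)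
  tendsto_of_ne_top : ∀ j, ∀ᵐ θ ∂m.μ, m.reservation θ ≠ ⊤ →
    Tendsto (m.w j θ) (𝓝[<] (m.reservation θ).toReal) (𝓝 ⊥)

open Classical in
/-- `|Dw_k(θ, p)| e^{u_k(θ, p)} / (e^{outside θ} + e^{u_k(θ, p)})` below the reservation price, and
`0` from the reservation price on. -/
noncomputable def psi (m : MixedLogitMarket T J F) (k : Fin J) (θ : T) (p : ℝ) : ℝ :=
  if ENNReal.ofReal p < m.reservation θ then
    |m.dw k θ p| * (m.expUtility k θ p / (Real.exp (m.outside θ) + m.expUtility k θ p))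
  else 0

/-- The condition under which the Leibniz rule holds for the Mixed Logit choice probabilities. -/
structure LeibnizAssumption (m : MixedLogitMarket T J F) : Prop where
  continuousOn : ∀ k, ∀ᵐ θ ∂m.μ, ContinuousOn (m.psi k θ) (pricesBelow m.maxReservation)
  dominated : ∀ k, ∀ p ∈ pricesBelow m.maxReservation, ∃ φ : T → ℝ, Integrable φ m.μ ∧
    (∀ θ, 0 ≤ φ θ) ∧ ∀ᶠ q in 𝓝 p, ∀ᵐ θ ∂m.μ, m.psi k θ q ≤ φ θ

/-- The diagonal matrix `Λ(p)`, with entries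
`λ_j(p) = ∫_{reservation > p_j} Dw_j(θ, p_j) P_j^L(θ, p) dμ(θ)`. -/
noncomputable def Lam (m : MixedLogitMarket T J F) (p : Fin J → ℝ) : Matrix (Fin J) (Fin J) ℝ :=
  Matrix.diagonal fun j =>
    ∫ θ in {θ | ENNReal.ofReal (p j) < m.reservation θ}, m.dw j θ (p j) * m.logitProb j θ p ∂m.μ

/-- The intra-firm part of the matrix `Γ(p)`, where
`γ_{j,k}(p) = ∫_{reservation > p_j, p_k} P_j^L(θ, p) P_k^L(θ, p) Dw_k(θ, p_k) dμ(θ)`. -/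
noncomputable def intraGam (m : MixedLogitMarket T J F) (p : Fin J → ℝ) :
    Matrix (Fin J) (Fin J) ℝ :=
  Matrix.of fun j k =>
    if m.firm j = m.firm k then
      ∫ θ in {θ | ENNReal.ofReal (p j) < m.reservation θ ∧ ENNReal.ofReal (p k) < m.reservation θ},
        m.logitProb j θ p * m.logitProb k θ p * m.dw k θ (p k) ∂m.μ
    else 0

/-- The matrix `Λ(p)⁻¹ Γ̃(p)ᵀ`, where `Γ̃(p)` is the intra-firm part of `Γ(p)`. -/
noncomputable def intraOmega (m : MixedLogitMarket T J F) (p : Fin J → ℝ) :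
    Matrix (Fin J) (Fin J) ℝ :=
  (m.Lam p)⁻¹ * (m.intraGam p)ᵀ

/-- The matrix norm induced by the sup norm on vectors (maximal absolute row sum). -/
noncomputable def matrixNorm (A : Matrix (Fin J) (Fin J) ℝ) : ℝ :=
  @norm _ Matrix.linftyOpNormedAddCommGroup.toNorm A

/-- The vectors of positive finite prices. -/
def positivePrices (J : ℕ) : Set (Fin J → ℝ) := {p | ∀ j, 0 < p j}

/-- `reservation` has infinite essential supremum, `‖Λ(p)⁻¹ P(p)‖_∞` is bounded and
`‖Ω̃(p)‖_∞` has a supremum of the form `1 - ε` with `ε ∈ (0, 1)`. -/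
structure BoundedAssumption (m : MixedLogitMarket T J F) : Prop where
  maxReservation_eq_top : m.maxReservation = ⊤
  exists_bound : ∃ M : ℝ, 0 < M ∧ ∀ p ∈ positivePrices J, ‖(m.Lam p)⁻¹ *ᵥ m.prob p‖ ≤ M
  exists_isLUB : ∃ ε : ℝ, 0 < ε ∧ ε < 1 ∧
    IsLUB ((fun p => matrixNorm (m.intraOmega p)) '' positivePrices J) (1 - ε)

/-- Expected profit of firm `f`. -/
noncomputable def profit (m : MixedLogitMarket T J F) (f : Fin F) (p : Fin J → ℝ) : ℝ :=
  ∑ j with m.firm j = f, m.prob p j * (p j - m.cost j)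

/-- `p` is simultaneously stationary: the choice probabilities are differentiable at `p`, and the
derivative of each firm's profit in the price of each of its products vanishes at `p`. -/
def IsSimultaneouslyStationary (m : MixedLogitMarket T J F) (p : Fin J → ℝ) : Prop :=
  DifferentiableAt ℝ m.prob p ∧
    ∀ j, HasDerivAt (fun t => m.profit (m.firm j) (Function.update p j t)) 0 (p j)

/-- The matrix of intra-firm price derivatives of the choice probabilities: its `(j, k)` entry is
the partial derivative of `P_j` in `p_k` if the same firm offers `j` and `k`, and `0` otherwise. -/
noncomputable def intraJacobian (m : MixedLogitMarket T J F) (p : Fin J → ℝ) :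
    Matrix (Fin J) (Fin J) ℝ :=
  Matrix.of fun j k =>
    if m.firm j = m.firm k then deriv (fun t => m.prob (Function.update p k t) j) (p k) else 0

/-- The markup map `η(p) = -(D̃P(p)ᵀ)⁻¹ P(p)`. -/
noncomputable def eta (m : MixedLogitMarket T J F) (p : Fin J → ℝ) : Fin J → ℝ :=
  -(((m.intraJacobian p)ᵀ)⁻¹ *ᵥ m.prob p)

end MixedLogitMarket

/-! ### Brouwer's fixed point theorem, by the Milnor–Rogers volume argument. -/

section Brouwer

open Metric Set

variable {E : Type*} [NormedAddCommGroup E] [InnerProductSpace ℝ E]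

/-! Let λ_j = ∫ |Dw_j| P_j^L and γ_{kj} = ∫ P_k^L |Dw_j| P_j^L, where integrands vanish beyond the
reservation price. Then ∂P_k/∂p_j = γ_{kj} - δ_{kj} λ_j, so the first-order conditions read λ_j (p_j
- c_j) = P_j + Σ_k γ_{kj} (p_k - c_k), the sum running over the products k of the firm of j. Markups
thus have to be a fixed point of `zeta`. The boundedness assumption becomes P_j ≤ M λ_j and Σ_k
γ_{kj} ≤ (1 - ε) λ_j. Hence markups at most R are sent to markups at most R once M ≤ ε R, and
Brouwer's theorem applies on a box (`exists_fixedPoint_zeta`). The second bound also makes the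
intra-firm Jacobian strictly column diagonally dominant, hence nonsingular, which gives the markup
equation.

The difficulty is the lower face of the box for products of zero cost, since utilities might blow up
at price 0. As p_k decreases, P_k grows at rate λ_k - γ_{kk} ≥ ε λ_k, while the mean log-denominator
grows at rate λ_k. Since P_k ≤ 1, the latter grows by at most 1/ε in total, so almost every
exponentiated utility stays bounded near price 0. This bounds P_j below uniformly in the other
prices (`exists_pos_le_prob`). Moreover t λ_j cannot stay above a positive constant as p_j = t tends
to 0, because 1/t is not integrable there (`exists_mul_lam_update_le`). So some low price t
satisfies t λ_j ≤ P_j throughout the face p_j = t, and truncating the map at t creates no spurious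
fixed point. -/

theorem ContinuousLinearMap.det_ne_zero_of_isUnit {A : E →L[ℝ] E} (hA : IsUnit A) :
    A.det ≠ 0 := by
  obtain ⟨u, rfl⟩ := hA
  intro h
  have h1 : ((u : E →L[ℝ] E) * (↑u⁻¹ : E →L[ℝ] E)).det = 1 := by
    rw [u.mul_inv]; simp [ContinuousLinearMap.det]
  have h2 : ((u : E →L[ℝ] E) * (↑u⁻¹ : E →L[ℝ] E)).det
      = (u : E →L[ℝ] E).det * (↑u⁻¹ : E →L[ℝ] E).det := by
    simp only [ContinuousLinearMap.det]
    rw [← LinearMap.det_comp]; rfl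
  rw [h2, h] at h1
  simp at h1

variable [FiniteDimensional ℝ E]

/-- Along the path 1 + sA, s ∈ [0, 1], the determinant starts at 1 and never vanishes, by the
Neumann series. -/
theorem ContinuousLinearMap.det_one_add_pos {A : E →L[ℝ] E} (hA : ‖A‖ < 1) :
    0 < (1 + A).det := by
  have hne : ∀ s ∈ Icc (0 : ℝ) 1, (1 + s • A).det ≠ 0 := by
    intro s hs
    apply ContinuousLinearMap.det_ne_zero_of_isUnit
    have : ‖-(s • A)‖ < 1 := by
      rw [norm_neg, norm_smul, Real.norm_of_nonneg hs.1]
      nlinarith [hs.1, hs.2, norm_nonneg A]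
    simpa using isUnit_one_sub_of_norm_lt_one this
  have hc : Continuous fun s : ℝ => (1 + s • A).det :=
    ContinuousLinearMap.continuous_det.comp (by fun_prop)
  by_contra! hle
  have h0 : (1 + (0 : ℝ) • A).det = 1 := by simp [ContinuousLinearMap.det]
  have hmem : (0 : ℝ) ∈ Icc ((1 + (1 : ℝ) • A).det) ((1 + (0 : ℝ) • A).det) := by
    rw [h0, one_smul]; exact ⟨hle, zero_le_one⟩
  obtain ⟨s, hs, hs0⟩ := intermediate_value_Icc' zero_le_one hc.continuousOn hmem
  exact hne s hs hs0

/-- `t ↦ det (1 + t A)` is a polynomial of degree at most the dimension. -/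
theorem ContinuousLinearMap.exists_polynomial_det_one_add_smul (A : E →L[ℝ] E) :
    ∃ q : Polynomial ℝ, q.degree < (Module.finrank ℝ E + 1 : ℕ) ∧
      ∀ t : ℝ, q.eval t = (1 + t • A).det := by
  let b := Module.finBasis ℝ E
  let M := LinearMap.toMatrix b b (A : E →ₗ[ℝ] E)
  refine ⟨((Polynomial.X : Polynomial ℝ) • M.map Polynomial.C
    + (1 : Matrix _ _ ℝ).map Polynomial.C).det, ?_, fun t => ?_⟩
  · refine lt_of_le_of_lt Polynomial.degree_le_natDegree ?_
    have := Polynomial.natDegree_det_X_add_C_le M 1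
    rw [Fintype.card_fin] at this
    exact_mod_cast Nat.lt_succ_of_le this
  · rw [← Polynomial.coe_evalRingHom, RingHom.map_det]
    simp only [ContinuousLinearMap.det]
    rw [← LinearMap.det_toMatrix b]
    congr 1
    have : ((1 + t • A : E →L[ℝ] E) : E →ₗ[ℝ] E) = 1 + t • (A : E →ₗ[ℝ] E) := rfl
    rw [this, map_add (LinearMap.toMatrix b b), map_smul (LinearMap.toMatrix b b),
      LinearMap.toMatrix_one]
    ext i j
    simp [Matrix.one_apply, M, apply_ite, add_comm, mul_comm t]

/-- There is no continuously differentiable retraction of the closed unit ball to its sphere. -/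
theorem not_exists_contDiffAt_retraction_sphere {r : E → E}
    (hr : ∀ x ∈ closedBall (0 : E) 1, ContDiffAt ℝ 1 r x)
    (hsph : ∀ x ∈ closedBall (0 : E) 1, ‖r x‖ = 1)
    (hid : ∀ x : E, ‖x‖ = 1 → r x = x) : False := by
  let _ : MeasurableSpace E := borel E
  have _ : BorelSpace E := ⟨rfl⟩
  let B := closedBall (0 : E) 1
  let U := ball (0 : E) 1
  have hUB : U ⊆ B := ball_subset_closedBall
  have hfc : ContinuousOn (fderiv ℝ r) B := fun x hx =>
    ((hr x hx).continuousAt_fderiv one_ne_zero).continuousWithinAt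
  have hdiff : ∀ x ∈ B, DifferentiableAt ℝ r x := fun x hx =>
    (hr x hx).differentiableAt one_ne_zero
  let g : E → E := fun x => r x - x
  have hg : ∀ x ∈ B, HasFDerivAt g (fderiv ℝ r x - 1) x := fun x hx =>
    (hdiff x hx).hasFDerivAt.sub (hasFDerivAt_id x)
  obtain ⟨C, hC⟩ := (isCompact_closedBall (0 : E) 1).exists_bound_of_continuousOn
    (f := fun x => fderiv ℝ r x - 1) (hfc.sub continuousOn_const)
  let L : ℝ := max C 1
  have hL1 : 1 ≤ L := le_max_right _ _
  have hL : ∀ x ∈ B, ‖fderiv ℝ r x - 1‖ ≤ L := fun x hx => (hC x hx).trans (le_max_left _ _)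
  have hLip : ∀ x ∈ B, ∀ y ∈ B, ‖g y - g x‖ ≤ L * ‖y - x‖ := fun x hx y hy =>
    (convex_closedBall (0 : E) 1).norm_image_sub_le_of_norm_hasFDerivWithin_le
      (fun z hz => (hg z hz).hasFDerivWithinAt) hL hx hy
  classical
  -- Extending the displacement by 0 keeps the Lipschitz constant: a segment leaving the ball
  -- crosses the sphere, where `g` vanishes.
  let G : E → E := fun x => if x ∈ U then g x else 0
  have hG0 : ∀ x, x ∉ U → G x = 0 := fun x hx => if_neg hx
  have hGU : ∀ x ∈ U, G x = g x := fun x hx => if_pos hx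
  have hg0 : ∀ x : E, ‖x‖ = 1 → g x = 0 := fun x hx => by simp [g, hid x hx]
  have hmix : ∀ x ∈ U, ∀ y ∉ U, ‖g x‖ ≤ L * ‖x - y‖ := by
    intro x hx y hy
    have hc : ContinuousOn (fun s : ℝ => ‖x + s • (y - x)‖) (Icc 0 1) := by fun_prop
    have hx1 : ‖x‖ < 1 := by simpa [U] using hx
    have hy1 : 1 ≤ ‖y‖ := by simpa [U] using hy
    obtain ⟨s, hs, hs1⟩ := intermediate_value_Icc zero_le_one hc
      (show (1 : ℝ) ∈ Icc _ _ by constructor <;> simp [hx1.le, hy1])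
    have hz : x + s • (y - x) ∈ B := by simpa [B] using hs1.le
    have := hLip _ hz _ (hUB hx)
    rw [hg0 _ hs1, sub_zero] at this
    refine this.trans ?_
    have : x - (x + s • (y - x)) = s • (x - y) := by module
    rw [this, norm_smul, Real.norm_of_nonneg hs.1]
    have := norm_nonneg (x - y)
    gcongr
    nlinarith [hs.2]
  have hGLip : ∀ x y, ‖G x - G y‖ ≤ L * ‖x - y‖ := by
    intro x y
    by_cases hx : x ∈ U <;> by_cases hy : y ∈ U
    · rw [hGU x hx, hGU y hy]; exact hLip _ (hUB hy) _ (hUB hx)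
    · rw [hGU x hx, hG0 y hy, sub_zero]; exact hmix x hx y hy
    · rw [hG0 x hx, hGU y hy, zero_sub, norm_neg, norm_sub_rev x]; exact hmix y hy x hx
    · rw [hG0 x hx, hG0 y hy]; simp; positivity
  -- For such t the map x + t G(x) is a small Lipschitz perturbation of the identity, hence a
  -- bijection of E. It fixes the complement of the open ball, so it maps the ball onto itself, and
  -- the change of variables formula gives the volume.
  have hvol : ∀ t : ℝ, 0 ≤ t → t * L < 1 →
      IntegrableOn (fun x => (1 + t • (fderiv ℝ r x - 1)).det) U ∧
      ∫ x in U, (1 + t • (fderiv ℝ r x - 1)).det = volume.real U := by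
    intro t ht0 ht
    have happ : ApproximatesLinearOn (fun x => x + t • G x)
        ((ContinuousLinearEquiv.refl ℝ E : E ≃L[ℝ] E) : E →L[ℝ] E) univ
        (Real.toNNReal (t * L)) := by
      refine ApproximatesLinearOn.approximatesLinearOn_iff_lipschitzOnWith.mpr ?_
      refine LipschitzOnWith.of_dist_le_mul fun x _ y _ => ?_
      have h : ((fun x => x + t • G x) - ⇑((ContinuousLinearEquiv.refl ℝ E : E ≃L[ℝ] E) :
        E →L[ℝ] E)) = fun x => t • G x := by ext; simp
      rw [h, dist_eq_norm, dist_eq_norm, Real.coe_toNNReal _ (by positivity), ← smul_sub,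
        norm_smul, Real.norm_of_nonneg ht0, mul_assoc]
      gcongr
      exact hGLip x y
    rcases subsingleton_or_nontrivial E with hE | hE
    · exfalso
      have := hsph 0 (by simp)
      rw [Subsingleton.elim (r 0) 0, norm_zero] at this
      exact zero_ne_one this
    have hcst : Subsingleton E ∨ Real.toNNReal (t * L) <
        ‖((ContinuousLinearEquiv.refl ℝ E).symm : E →L[ℝ] E)‖₊⁻¹ := by
      right
      have : ‖((ContinuousLinearEquiv.refl ℝ E).symm : E →L[ℝ] E)‖₊ = 1 :=
        ContinuousLinearMap.nnnorm_id
      rw [this, inv_one]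
      exact_mod_cast (Real.toNNReal_lt_one).2 ht
    have hinj : Function.Injective (fun x => x + t • G x) := by
      simpa [injOn_univ] using happ.injOn hcst
    have hsurj : Function.Surjective (fun x => x + t • G x) := happ.surjective hcst
    have hfix : ∀ x, x ∉ U → x + t • G x = x := fun x hx => by simp [hG0 x hx]
    have himg : (fun x => x + t • G x) '' U = U := by
      ext y
      constructor
      · rintro ⟨x, hx, rfl⟩
        by_contra hy
        have := hinj (hfix _ hy)
        exact hy (by rw [this]; exact hx)
      · intro hy
        obtain ⟨x, hx⟩ := hsurj y
        by_cases hxU : x ∈ U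
        · exact ⟨x, hxU, hx⟩
        · exfalso; apply hxU
          have := hfix x hxU
          simp only at hx
          rw [this] at hx
          rwa [hx]
    have hder : ∀ x ∈ U, HasFDerivWithinAt (fun x => x + t • G x)
        (1 + t • (fderiv ℝ r x - 1)) U x := by
      intro x hx
      have : HasFDerivWithinAt (fun x => x + t • g x) (1 + t • (fderiv ℝ r x - 1)) U x :=
        ((hasFDerivAt_id x).add ((hg x (hUB hx)).const_smul t)).hasFDerivWithinAt
      exact this.congr (fun y hy => by rw [hGU y hy]) (by rw [hGU x hx])
    have hpos : ∀ x ∈ U, 0 < (1 + t • (fderiv ℝ r x - 1)).det := by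
      intro x hx
      apply ContinuousLinearMap.det_one_add_pos
      rw [norm_smul, Real.norm_of_nonneg ht0]
      exact lt_of_le_of_lt (by gcongr; exact hL x (hUB hx)) ht
    constructor
    · refine IntegrableOn.mono_set (t := B) ?_ hUB
      refine ContinuousOn.integrableOn_compact (isCompact_closedBall _ _) ?_
      exact ContinuousLinearMap.continuous_det.comp_continuousOn
        (continuousOn_const.add ((hfc.sub continuousOn_const).const_smul t))
    · have := integral_image_eq_integral_abs_det_fderiv_smul volume (measurableSet_ball)
        hder hinj.injOn (fun _ => (1 : ℝ))
      rw [himg] at this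
      simp only [smul_eq_mul, mul_one, integral_const, MeasurableSet.univ, measureReal_restrict_apply,
        univ_inter] at this
      rw [this]
      exact (setIntegral_congr_fun measurableSet_ball fun x hx => by
        simp only [abs_of_pos (hpos x hx)])
  let n := Module.finrank ℝ E + 1
  let s : Finset (Fin n) := Finset.univ
  -- These dim + 1 nodes lie in [0, 1/L), where the volume identity holds. They determine a
  -- polynomial of degree at most dim, so Lagrange interpolation carries the identity over to t = 1.
  let v : Fin n → ℝ := fun i => (i : ℝ) / (n * L)
  have hn : (0 : ℝ) < n := by positivity
  have hv : InjOn v s := by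
    intro i _ j _ h
    have : (i : ℝ) / (n * L) = (j : ℝ) / (n * L) := h
    rw [div_left_inj' (by positivity)] at this
    exact Fin.ext (by exact_mod_cast this)
  have hv0 : ∀ i, 0 ≤ v i := fun i => by positivity
  have hv1 : ∀ i, v i * L < 1 := fun i => by
    have : v i * L = (i : ℝ) / n := by simp only [v]; field_simp
    rw [this, div_lt_one hn]
    exact_mod_cast i.2
  have hpol : ∀ x, (fderiv ℝ r x).det = ∑ i, (1 + v i • (fderiv ℝ r x - 1)).det *
      (Lagrange.basis s v i).eval 1 := by
    intro x
    obtain ⟨q, hq, hqe⟩ := ContinuousLinearMap.exists_polynomial_det_one_add_smul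
      (fderiv ℝ r x - 1)
    have h1 : q.eval 1 = (fderiv ℝ r x).det := by rw [hqe]; simp
    rw [← h1]
    conv_lhs => rw [Lagrange.eq_interpolate (f := q) (s := s) (v := v) hv (by simpa [s, n] using hq)]
    rw [Lagrange.interpolate_apply, Polynomial.eval_finsetSum]
    simp [hqe, s]
  have hone : ∑ i, (Lagrange.basis s v i).eval 1 = 1 := by
    have := Lagrange.sum_basis (s := s) (v := v) hv ⟨⟨0, by positivity⟩, by simp [s]⟩
    have := congrArg (Polynomial.eval 1) this
    simpa [Polynomial.eval_finsetSum, s] using this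
  have htot : ∫ x in U, (fderiv ℝ r x).det = volume.real U := by
    simp_rw [hpol]
    rw [integral_finsetSum _ fun i _ => ((hvol (v i) (hv0 i) (hv1 i)).1.mul_const _)]
    simp_rw [integral_mul_const, (hvol (v _) (hv0 _) (hv1 _)).2]
    rw [← Finset.mul_sum, hone, mul_one]
  -- ‖r‖² is constant, so r(x) is orthogonal to the range of the derivative; an invertible
  -- derivative would have the unit vector r(x) in its range.
  have hzero : ∀ x ∈ U, (fderiv ℝ r x).det = 0 := by
    intro x hx
    by_contra hdet
    have hder : HasFDerivAt (fun y => ‖r y‖ ^ 2) (2 • (innerSL ℝ (r x)).comp (fderiv ℝ r x)) x :=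
      (hdiff x (hUB hx)).hasFDerivAt.norm_sq
    have hconst : HasFDerivAt (fun y => ‖r y‖ ^ 2) (0 : E →L[ℝ] ℝ) x := by
      refine (hasFDerivAt_const (1 : ℝ) x).congr_of_eventuallyEq ?_
      filter_upwards [isOpen_ball.mem_nhds hx] with y hy
      rw [hsph y (hUB hy)]; norm_num
    have heq := hder.unique hconst
    have hu : IsUnit (LinearMap.det (fderiv ℝ r x : E →ₗ[ℝ] E)) := isUnit_iff_ne_zero.2 hdet
    obtain ⟨y, hy⟩ := (LinearMap.equivOfIsUnitDet hu).surjective (r x)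
    have hy' : fderiv ℝ r x y = r x := by simpa using hy
    have := congrArg (fun A : E →L[ℝ] ℝ => A y) heq
    simp [hy', hsph x (hUB hx)] at this
  rw [setIntegral_congr_fun measurableSet_ball hzero] at htot
  have : 0 < volume.real U := by
    rw [measureReal_def]
    exact ENNReal.toReal_pos (measure_ball_pos _ _ one_pos).ne' measure_ball_lt_top.ne
  simp at htot
  exact this.ne htot

/-- Without a fixed point, pushing x away from h(x) until it meets the sphere is a retraction. Here
`s x` is the larger root of ‖x + s u(x)‖² = 1; its reduced discriminant `d` is positive on the
closed ball, so the root is C¹. On the sphere `b` is positive, and the root is 0. -/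
theorem exists_fixedPoint_of_contDiff {h : E → E} (hh : ContDiff ℝ 1 h) (hb : ∀ x, ‖h x‖ ≤ 1) :
    ∃ x, h x = x := by
  by_contra! hne
  let u : E → E := fun x => x - h x
  have hu : ∀ x, 0 < ‖u x‖ ^ 2 := fun x => by
    have : u x ≠ 0 := sub_ne_zero.2 (hne x).symm
    positivity
  let b : E → ℝ := fun x => inner ℝ x (u x)
  let d : E → ℝ := fun x => b x ^ 2 + ‖u x‖ ^ 2 * (1 - ‖x‖ ^ 2)
  let s : E → ℝ := fun x => (-b x + √(d x)) / ‖u x‖ ^ 2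
  have hbpos : ∀ x, ‖x‖ = 1 → 0 < b x := by
    intro x hx
    have h1 : ‖u x‖ ^ 2 = ‖x‖ ^ 2 - 2 * inner ℝ x (h x) + ‖h x‖ ^ 2 := norm_sub_sq_real x (h x)
    have h2 : b x = ‖x‖ ^ 2 - inner ℝ x (h x) := by
      simp only [b, u, inner_sub_right, real_inner_self_eq_norm_sq]
    have h3 := hu x
    have h4 : ‖h x‖ ^ 2 ≤ 1 := pow_le_one₀ (norm_nonneg _) (hb x)
    rw [hx] at h1 h2
    linarith
  have hd : ∀ x ∈ closedBall (0 : E) 1, 0 < d x := by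
    intro x hx
    have hx1 : ‖x‖ ≤ 1 := by simpa using hx
    rcases hx1.eq_or_lt with h1 | h1
    · have := hbpos x h1
      simp only [d, h1]
      nlinarith
    · have h2 : ‖x‖ ^ 2 < 1 := pow_lt_one₀ (norm_nonneg _) h1 two_ne_zero
      have := mul_pos (hu x) (sub_pos.2 h2)
      have := sq_nonneg (b x)
      simp only [d]
      linarith
  have huc : ContDiff ℝ 1 u := contDiff_id.sub hh
  have hbc : ContDiff ℝ 1 b := contDiff_id.inner ℝ huc
  have hdc : ContDiff ℝ 1 d :=
    (hbc.pow 2).add ((huc.norm_sq ℝ).mul (contDiff_const.sub (contDiff_id.norm_sq ℝ)))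
  refine not_exists_contDiffAt_retraction_sphere (r := fun x => x + s x • u x) ?_ ?_ ?_
  · intro x hx
    refine contDiffAt_id.add (ContDiffAt.smul ?_ huc.contDiffAt)
    exact (hbc.contDiffAt.neg.add (hdc.contDiffAt.sqrt (hd x hx).ne')).div
      (huc.norm_sq ℝ).contDiffAt (hu x).ne'
  · intro x hx
    have h1 : ‖x + s x • u x‖ ^ 2 = ‖x‖ ^ 2 + 2 * (s x * b x) + s x ^ 2 * ‖u x‖ ^ 2 := by
      rw [norm_add_sq_real, inner_smul_right, norm_smul, mul_pow, Real.norm_eq_abs, sq_abs]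
    have h2 : s x * ‖u x‖ ^ 2 = -b x + √(d x) := div_mul_cancel₀ _ (hu x).ne'
    have h3 : √(d x) ^ 2 = d x := Real.sq_sqrt (hd x hx).le
    have h4 : ‖x + s x • u x‖ ^ 2 = 1 := by
      rw [h1]
      have h5 : (s x * ‖u x‖ ^ 2 + b x) ^ 2 = d x := by
        rw [h2, neg_add_cancel_comm, h3]
      have h6 : ‖u x‖ ^ 2 * (2 * (s x * b x) + s x ^ 2 * ‖u x‖ ^ 2)
          = ‖u x‖ ^ 2 * (1 - ‖x‖ ^ 2) := by
        have : d x = b x ^ 2 + ‖u x‖ ^ 2 * (1 - ‖x‖ ^ 2) := rfl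
        rw [this] at h5
        linear_combination h5
      have h7 := mul_left_cancel₀ (hu x).ne' h6
      linarith
    exact (pow_eq_one_iff_of_nonneg (norm_nonneg _) two_ne_zero).1 h4
  · intro x hx
    have : s x = 0 := by
      simp only [s, d, hx]
      rw [one_pow, sub_self, mul_zero, add_zero, Real.sqrt_sq (hbpos x hx).le]
      simp
    simp [this]

/-- **Brouwer's fixed point theorem** for maps into the unit ball. -/
theorem exists_fixedPoint_of_continuous_of_norm_le_one {h : E → E} (hh : Continuous h)
    (hb : ∀ x, ‖h x‖ ≤ 1) : ∃ x, h x = x := by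
  by_contra! hne
  obtain ⟨x₀, -, hx₀⟩ := (isCompact_closedBall (0 : E) 1).exists_isMinOn
    (nonempty_closedBall.2 zero_le_one)
    (f := fun x => ‖x - h x‖) (continuous_id.sub hh).norm.continuousOn
  have hε : 0 < ‖x₀ - h x₀‖ := norm_pos_iff.2 (sub_ne_zero.2 (hne x₀).symm)
  -- A C¹ map closer to `h` than its minimal displacement on the ball has a fixed point, which `h`
  -- would move by less than that minimum.
  obtain ⟨g, hg⟩ := exists_contMDiffMap_forall_mem_convex_of_local_const (n := 1)
    (modelWithCornersSelf ℝ E) (t := fun x => ball (h x) ‖x₀ - h x₀‖ ∩ closedBall 0 1)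
    (fun x => (convex_ball _ _).inter (convex_closedBall _ _)) (fun x => by
      refine ⟨h x, ?_⟩
      filter_upwards [hh.continuousAt.preimage_mem_nhds (ball_mem_nhds (h x) hε)] with y hy
      exact ⟨by simpa [dist_comm] using hy, by simpa using hb x⟩)
  have hg1 : ∀ x, ‖g x‖ ≤ 1 := fun x => by simpa using (hg x).2
  obtain ⟨x, hx⟩ := exists_fixedPoint_of_contDiff (h := g) g.contMDiff.contDiff hg1
  have h1 : ‖x₀ - h x₀‖ ≤ ‖x - h x‖ := hx₀ (by simpa [hx] using hg1 x)
  have h2 : ‖x - h x‖ < ‖x₀ - h x₀‖ := by simpa [dist_eq_norm, hx] using (hg x).1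
  exact h1.not_gt h2

/-- **Brouwer's fixed point theorem** for boxes. -/
theorem exists_fixedPoint_of_continuousOn_Icc {n : ℕ} {a b : Fin n → ℝ} (hab : a ≤ b)
    {f : (Fin n → ℝ) → Fin n → ℝ} (hf : ContinuousOn f (Icc a b))
    (hmaps : MapsTo f (Icc a b) (Icc a b)) : ∃ x ∈ Icc a b, f x = x := by
  let e := EuclideanSpace.equiv (Fin n) ℝ
  -- Clamping to the box makes `f` globally continuous; rescaling by `S` then brings its values into
  -- the Euclidean unit ball.
  let c : (Fin n → ℝ) → Fin n → ℝ := fun x => a ⊔ (b ⊓ x)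
  have hc : ∀ x, c x ∈ Icc a b := fun x => ⟨le_sup_left, sup_le hab inf_le_left⟩
  have hcid : ∀ x ∈ Icc a b, c x = x := fun x hx => by
    simp only [c]; rw [inf_eq_right.2 hx.2, sup_eq_right.2 hx.1]
  have hcc : Continuous c := continuous_pi fun i =>
    continuous_const.max (continuous_const.min (continuous_apply i))
  have hfc : Continuous fun x => f (c x) := hf.comp_continuous hcc hc
  obtain ⟨R, hR⟩ := (isCompact_Icc (a := a) (b := b)).exists_bound_of_continuousOn
    (f := fun x => e.symm x) e.symm.continuous.continuousOn
  let S := max R 1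
  have hS : 0 < S := lt_max_of_lt_right one_pos
  obtain ⟨x, hx⟩ := exists_fixedPoint_of_continuous_of_norm_le_one
    (h := fun x => S⁻¹ • e.symm (f (c (e (S • x)))))
    (Continuous.const_smul (e.symm.continuous.comp
      (hfc.comp (e.continuous.comp (continuous_const_smul S)))) S⁻¹)
    (fun x => by
      rw [norm_smul, norm_inv, Real.norm_of_nonneg hS.le, inv_mul_le_one₀ hS]
      exact (hR _ (hmaps (hc _))).trans (le_max_left _ _))
  have hx2 : f (c (e (S • x))) = e (S • x) := by
    conv_rhs => rw [← hx]
    simp [smul_smul, hS.ne']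
  have hmem : e (S • x) ∈ Icc a b := hx2 ▸ hmaps (hc _)
  exact ⟨e (S • x), hmem, by rw [hcid _ hmem] at hx2; exact hx2⟩

end Brouwer

/-! ### Regularity of individual utilities and domination on compact boxes. -/

namespace MixedLogitMarket

variable {T : Type*} [MeasurableSpace T] {J F : ℕ}

theorem expUtility_nonneg (m : MixedLogitMarket T J F) (j : Fin J) (θ : T) (t : ℝ) :
    0 ≤ m.expUtility j θ t := ENNReal.toReal_nonneg

theorem expUtility_eq_mul (m : MixedLogitMarket T J F) (j : Fin J) (θ : T) (t : ℝ) :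
    m.expUtility j θ t = (EReal.exp (m.w j θ t)).toReal * Real.exp (m.v j θ) := by
  rw [expUtility, utility, EReal.exp_add, ENNReal.toReal_mul, EReal.exp_coe,
    ENNReal.toReal_ofReal (Real.exp_pos _).le]

theorem expUtility_of_ne_bot (m : MixedLogitMarket T J F) {j : Fin J} {θ : T} {t : ℝ}
    (h : m.w j θ t ≠ ⊥) :
    m.expUtility j θ t = Real.exp ((m.w j θ t).toReal + m.v j θ) := by
  rw [expUtility_eq_mul, Real.exp_add]
  congr 1
  conv_lhs => rw [← EReal.coe_toReal (m.w_ne_top j θ t) h]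
  rw [EReal.exp_coe, ENNReal.toReal_ofReal (Real.exp_pos _).le]

theorem expUtility_of_eq_bot (m : MixedLogitMarket T J F) {j : Fin J} {θ : T} {t : ℝ}
    (h : m.w j θ t = ⊥) : m.expUtility j θ t = 0 := by
  rw [expUtility_eq_mul, h]; simp

theorem measurable_expUtility (m : MixedLogitMarket T J F) (j : Fin J) (t : ℝ) :
    Measurable fun θ => m.expUtility j θ t := by
  simp_rw [expUtility_eq_mul]
  exact ((EReal.measurable_exp.comp (m.w_measurable j t)).ennreal_toReal).mul
    (Real.measurable_exp.comp (m.v_measurable j))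

theorem psi_nonneg (m : MixedLogitMarket T J F) (k : Fin J) (θ : T) (t : ℝ) :
    0 ≤ m.psi k θ t := by
  unfold psi
  have := m.expUtility_nonneg k θ t
  have := Real.exp_pos (m.outside θ)
  split_ifs <;> positivity

theorem isOpen_pricesBelow (s : ℝ≥0∞) : IsOpen (pricesBelow s) :=
  (isOpen_lt continuous_const continuous_id).inter
    (isOpen_lt ENNReal.continuous_ofReal continuous_const)

theorem pricesBelow_top : pricesBelow ⊤ = Set.Ioi 0 := by
  ext t; simp [pricesBelow]

/-- The regularity of the exponentiated utilities of an individual on which the analysis of the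
choice probabilities rests. -/
structure IsRegular (m : MixedLogitMarket T J F) (θ : T) : Prop where
  continuousOn_psi : ∀ k, ContinuousOn (m.psi k θ) (Set.Ioi 0)
  hasDerivAt : ∀ k t, 0 < t → HasDerivAt (m.expUtility k θ)
    (-(m.psi k θ t * (Real.exp (m.outside θ) + m.expUtility k θ t))) t
  dw_mul : ∀ k t, 0 < t → ENNReal.ofReal t < m.reservation θ →
    m.dw k θ t * m.expUtility k θ t =
      -(m.psi k θ t * (Real.exp (m.outside θ) + m.expUtility k θ t))
  expUtility_pos : ∀ k t, 0 < t → ENNReal.ofReal t < m.reservation θ → 0 < m.expUtility k θ t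
  expUtility_eq_zero : ∀ k t, 0 < t → m.reservation θ ≤ ENNReal.ofReal t →
    m.expUtility k θ t = 0
  strictAntiOn : ∀ k, StrictAntiOn (m.expUtility k θ) (pricesBelow (m.reservation θ))

theorem psi_of_le (m : MixedLogitMarket T J F) {k : Fin J} {θ : T} {t : ℝ}
    (h : m.reservation θ ≤ ENNReal.ofReal t) : m.psi k θ t = 0 := by
  unfold psi; rw [if_neg h.not_gt]

/-- Below the reservation price this is the chain rule, and above it everything is 0. Continuity of
ψ glues the two pieces together at the reservation price. -/
theorem ae_isRegular {m : MixedLogitMarket T J F} (hU : m.UtilityAssumption)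
    (hL : m.LeibnizAssumption) (htop : m.maxReservation = ⊤) : ∀ᵐ θ ∂m.μ, m.IsRegular θ := by
  filter_upwards [ae_all_iff.2 hU.finite, ae_all_iff.2 hU.contDiffOn, ae_all_iff.2 hU.strictAntiOn,
    ae_all_iff.2 hU.eq_bot, ae_all_iff.2 hU.tendsto_of_ne_top, ae_all_iff.2 hL.continuousOn]
    with θ hfin hcd hanti hbot htend hpsi
  rw [htop, pricesBelow_top] at hpsi
  have hA := Real.exp_pos (m.outside θ)
  have hEpos : ∀ k t, t ∈ pricesBelow (m.reservation θ) → 0 < m.expUtility k θ t := by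
    intro k t ht
    rw [m.expUtility_of_ne_bot (hfin k t ht)]
    exact Real.exp_pos _
  have hEzero : ∀ k t, 0 < t → m.reservation θ ≤ ENNReal.ofReal t → m.expUtility k θ t = 0 :=
    fun k t ht h => m.expUtility_of_eq_bot (hbot k t ht.le h)
  have hwanti : ∀ k, StrictAntiOn (fun t => (m.w k θ t).toReal) (pricesBelow (m.reservation θ)) :=
    fun k s hs t ht hst => by
      have := hanti k hs ht hst
      rwa [← EReal.coe_toReal (m.w_ne_top k θ t) (hfin k t ht),
        ← EReal.coe_toReal (m.w_ne_top k θ s) (hfin k s hs), EReal.coe_lt_coe_iff] at this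
  have hdw : ∀ k t, t ∈ pricesBelow (m.reservation θ) →
      HasDerivAt (fun t => (m.w k θ t).toReal) (m.dw k θ t) t := fun k t ht =>
    (((hcd k).contDiffAt ((isOpen_pricesBelow _).mem_nhds ht)).differentiableAt
      one_ne_zero).hasDerivAt
  have hdw_le : ∀ k t, t ∈ pricesBelow (m.reservation θ) → m.dw k θ t ≤ 0 := by
    intro k t ht
    have hnhds := (isOpen_pricesBelow (m.reservation θ)).mem_nhds ht
    have h1 := (hwanti k).antitoneOn.derivWithin_nonpos (x := t)
    rwa [derivWithin_of_mem_nhds hnhds] at h1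
  have hmul : ∀ k t, t ∈ pricesBelow (m.reservation θ) → m.dw k θ t * m.expUtility k θ t =
      -(m.psi k θ t * (Real.exp (m.outside θ) + m.expUtility k θ t)) := by
    intro k t ht
    have hE := hEpos k t ht
    rw [psi, if_pos ht.2, abs_of_nonpos (hdw_le k t ht)]
    field_simp
  have hder : ∀ k t, t ∈ pricesBelow (m.reservation θ) → HasDerivAt (m.expUtility k θ)
      (-(m.psi k θ t * (Real.exp (m.outside θ) + m.expUtility k θ t))) t := by
    intro k t ht
    rw [← hmul k t ht]
    have h1 : HasDerivAt (fun s => Real.exp ((m.w k θ s).toReal + m.v k θ))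
        (Real.exp ((m.w k θ t).toReal + m.v k θ) * m.dw k θ t) t :=
      ((hdw k t ht).add_const _).exp
    rw [← m.expUtility_of_ne_bot (hfin k t ht), mul_comm] at h1
    refine h1.congr_of_eventuallyEq ?_
    filter_upwards [(isOpen_pricesBelow (m.reservation θ)).mem_nhds ht] with s hs
    exact m.expUtility_of_ne_bot (hfin k s hs)
  refine ⟨hpsi, fun k t ht => ?_, fun k t h0 h1 => hmul k t ⟨h0, h1⟩,
    fun k t h0 h1 => hEpos k t ⟨h0, h1⟩, hEzero, fun k s hs t ht hst => ?_⟩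
  · rcases lt_or_ge (ENNReal.ofReal t) (m.reservation θ) with h | h
    · exact hder k t ⟨ht, h⟩
    rw [m.psi_of_le h, zero_mul, neg_zero]
    have hright : HasDerivWithinAt (m.expUtility k θ) 0 (Set.Ici t) t :=
      (hasDerivWithinAt_const t _ (0 : ℝ)).congr
        (fun s hs => hEzero k s (ht.trans_le hs) (h.trans (ENNReal.ofReal_le_ofReal hs)))
        (hEzero k t ht h)
    suffices hleft : HasDerivWithinAt (m.expUtility k θ) 0 (Set.Iic t) t by
      have := hleft.union hright
      rwa [Set.Iic_union_Ici, hasDerivWithinAt_univ] at this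
    rcases h.lt_or_eq with h | h
    · have hev : m.expUtility k θ =ᶠ[𝓝 t] fun _ => 0 := by
        filter_upwards [ENNReal.continuous_ofReal.continuousAt.eventually (lt_mem_nhds h),
          lt_mem_nhds ht] with s hs hs0
        exact hEzero k s hs0 hs.le
      exact ((hasDerivAt_const t (0 : ℝ)).congr_of_eventuallyEq hev).hasDerivWithinAt
    have hne : m.reservation θ ≠ ⊤ := by rw [h]; exact ENNReal.ofReal_ne_top
    have htr : (m.reservation θ).toReal = t := by rw [h, ENNReal.toReal_ofReal ht.le]
    have hw := htend k hne
    rw [htr] at hw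
    have hlimE : Tendsto (m.expUtility k θ) (𝓝[<] t) (𝓝 0) := by
      have h1 : Tendsto (fun s => (EReal.exp (m.w k θ s)).toReal) (𝓝[<] t)
          (𝓝 (EReal.exp ⊥).toReal) :=
        (ENNReal.tendsto_toReal (by simp)).comp
          ((ENNReal.continuous_exp.tendsto ⊥).comp hw)
      have h2 := h1.mul_const (Real.exp (m.v k θ))
      simp only [EReal.exp_bot, ENNReal.toReal_zero, zero_mul] at h2
      exact h2.congr fun s => (m.expUtility_eq_mul k θ s).symm
    have hsub : Set.Ioo 0 t ⊆ pricesBelow (m.reservation θ) := fun s hs =>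
      ⟨hs.1, by rw [h]; exact (ENNReal.ofReal_lt_ofReal_iff ht).2 hs.2⟩
    have hmem : Set.Ioo 0 t ∈ 𝓝[<] t := Ioo_mem_nhdsLT ht
    -- Since ψ is continuous and vanishes at the reservation price, the derivatives from the left
    -- tend to 0, and so the left derivative there is 0.
    refine hasDerivWithinAt_Iic_of_tendsto_deriv (s := Set.Ioo 0 t)
      (fun s hs => (hder k s (hsub hs)).differentiableAt.differentiableWithinAt) ?_ hmem ?_
    · rw [ContinuousWithinAt, hEzero k t ht h.le]
      exact hlimE.mono_left (nhdsWithin_mono _ Set.Ioo_subset_Iio_self)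
    · have h1 : Tendsto (m.psi k θ) (𝓝[<] t) (𝓝 0) := by
        have := ((hpsi k).continuousAt (Ioi_mem_nhds ht)).tendsto
        rw [m.psi_of_le h.le] at this
        exact this.mono_left nhdsWithin_le_nhds
      have h2 := (h1.mul (hlimE.const_add (Real.exp (m.outside θ)))).neg
      rw [zero_mul, neg_zero] at h2
      refine h2.congr' ?_
      filter_upwards [hmem] with s hs
      exact (hder k s (hsub hs)).deriv.symm
  · rw [m.expUtility_of_ne_bot (hfin k s hs), m.expUtility_of_ne_bot (hfin k t ht)]
    exact Real.exp_lt_exp.2 (by linarith [hwanti k hs ht hst])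

/-- On compact boxes of positive prices the functions `psi` are dominated by an integrable
function. -/
def IsDominated (m : MixedLogitMarket T J F) : Prop :=
  ∀ a b : Fin J → ℝ, a ∈ positivePrices J → ∃ Φ : T → ℝ, Integrable Φ m.μ ∧
    ∀ᵐ θ ∂m.μ, ∀ q ∈ Set.Icc a b, ∀ k, m.psi k θ (q k) ≤ Φ θ

/-- Compactness turns the local bounds into one bound. The exceptional null set is made independent
of the price by using rational prices first and then continuity of ψ. -/
theorem exists_dominating_Icc {m : MixedLogitMarket T J F} (hR : ∀ᵐ θ ∂m.μ, m.IsRegular θ)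
    (hL : m.LeibnizAssumption) (htop : m.maxReservation = ⊤) (k : Fin J) {a b : ℝ} (ha : 0 < a) :
    ∃ φ : T → ℝ, Integrable φ m.μ ∧ (∀ θ, 0 ≤ φ θ) ∧
      ∀ᵐ θ ∂m.μ, ∀ t ∈ Set.Icc a b, m.psi k θ t ≤ φ θ := by
  refine isCompact_Icc.induction_on (s := Set.Icc a b) (p := fun s => ∃ φ : T → ℝ,
    Integrable φ m.μ ∧ (∀ θ, 0 ≤ φ θ) ∧ ∀ᵐ θ ∂m.μ, ∀ t ∈ s, m.psi k θ t ≤ φ θ) ?_ ?_ ?_ ?_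
  · exact ⟨0, integrable_zero _ _ _, fun _ => le_rfl, by simp⟩
  · rintro s t hst ⟨φ, h1, h2, h3⟩
    exact ⟨φ, h1, h2, h3.mono fun θ h x hx => h x (hst hx)⟩
  · rintro s t ⟨φ, h1, h2, h3⟩ ⟨φ', h1', h2', h3'⟩
    refine ⟨fun θ => φ θ + φ' θ, h1.add h1', fun θ => add_nonneg (h2 θ) (h2' θ), ?_⟩
    filter_upwards [h3, h3'] with θ h h' x hx
    rcases hx with hx | hx
    · linarith [h x hx, h2' θ]
    · linarith [h' x hx, h2 θ]
  · intro t ht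
    have ht0 : 0 < t := ha.trans_le ht.1
    obtain ⟨φ, h1, h2, h3⟩ := hL.dominated k t (by rw [htop, pricesBelow_top]; exact ht0)
    obtain ⟨U, hU, hUo, htU⟩ := eventually_nhds_iff.1 (h3.and (lt_mem_nhds ht0))
    refine ⟨U, mem_nhdsWithin_of_mem_nhds (hUo.mem_nhds htU), φ, h1, h2, ?_⟩
    have hq : ∀ᵐ θ ∂m.μ, ∀ r : ℚ, (r : ℝ) ∈ U → m.psi k θ r ≤ φ θ :=
      ae_all_iff.2 fun r => by
        by_cases hr : (r : ℝ) ∈ U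
        · exact (hU r hr).1.mono fun _ h _ => h
        · exact Eventually.of_forall fun _ h => absurd h hr
    filter_upwards [hR, hq] with θ hθ hθq s hs
    by_contra! hlt
    have hev : {x | φ θ < m.psi k θ x} ∩ U ∈ 𝓝 s :=
      inter_mem ((hθ.continuousOn_psi k).continuousAt (Ioi_mem_nhds (hU s hs).2)
        |>.eventually (lt_mem_nhds hlt)) (hUo.mem_nhds hs)
    obtain ⟨r, hr1, hr2⟩ := (Rat.denseRange_cast (𝕜 := ℝ)).mem_nhds hev
    exact (hθq r hr2).not_gt hr1

theorem isDominated {m : MixedLogitMarket T J F} (hR : ∀ᵐ θ ∂m.μ, m.IsRegular θ)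
    (hL : m.LeibnizAssumption) (htop : m.maxReservation = ⊤) : m.IsDominated := by
  intro a b ha
  choose φ h1 h2 h3 using fun k => exists_dominating_Icc hR hL htop k (b := b k) (ha k)
  refine ⟨fun θ => ∑ k, φ k θ, integrable_finsetSum _ fun k _ => h1 k, ?_⟩
  filter_upwards [ae_all_iff.2 h3] with θ hθ q hq k
  exact (hθ k (q k) ⟨hq.1 k, hq.2 k⟩).trans
    (Finset.single_le_sum (f := fun k => φ k θ) (fun i _ => h2 i θ) (Finset.mem_univ k))

/-! ### Logit derivatives and differentiation under the integral sign. -/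

/-- The denominator of the Logit choice probabilities. -/
noncomputable def denom (m : MixedLogitMarket T J F) (θ : T) (p : Fin J → ℝ) : ℝ :=
  Real.exp (m.outside θ) + ∑ k, m.expUtility k θ (p k)

/-- The rate at which the logarithm of the denominator decreases in the `k`-th price. -/
noncomputable def rate (m : MixedLogitMarket T J F) (k : Fin J) (θ : T) (p : Fin J → ℝ) : ℝ :=
  m.psi k θ (p k) * (Real.exp (m.outside θ) + m.expUtility k θ (p k)) / m.denom θ p

theorem logitProb_eq_div (m : MixedLogitMarket T J F) (j : Fin J) (θ : T) (p : Fin J → ℝ) :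
    m.logitProb j θ p = m.expUtility j θ (p j) / m.denom θ p := rfl

theorem add_expUtility_le_denom (m : MixedLogitMarket T J F) (k : Fin J) (θ : T)
    (p : Fin J → ℝ) : Real.exp (m.outside θ) + m.expUtility k θ (p k) ≤ m.denom θ p := by
  unfold denom
  gcongr
  exact Finset.single_le_sum (f := fun k => m.expUtility k θ (p k))
    (fun i _ => m.expUtility_nonneg i θ _) (Finset.mem_univ k)

theorem exp_le_denom (m : MixedLogitMarket T J F) (θ : T) (p : Fin J → ℝ) :
    Real.exp (m.outside θ) ≤ m.denom θ p :=
  le_add_of_nonneg_right (Finset.sum_nonneg fun k _ => m.expUtility_nonneg k θ _)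

theorem denom_pos (m : MixedLogitMarket T J F) (θ : T) (p : Fin J → ℝ) : 0 < m.denom θ p :=
  (Real.exp_pos _).trans_le (m.exp_le_denom θ p)

theorem logitProb_nonneg (m : MixedLogitMarket T J F) (j : Fin J) (θ : T) (p : Fin J → ℝ) :
    0 ≤ m.logitProb j θ p := div_nonneg (m.expUtility_nonneg j θ _) (m.denom_pos θ p).le

theorem logitProb_le_one (m : MixedLogitMarket T J F) (j : Fin J) (θ : T) (p : Fin J → ℝ) :
    m.logitProb j θ p ≤ 1 := by
  rw [logitProb_eq_div, div_le_one (m.denom_pos θ p)]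
  linarith [m.add_expUtility_le_denom j θ p, Real.exp_pos (m.outside θ)]

theorem rate_nonneg (m : MixedLogitMarket T J F) (k : Fin J) (θ : T) (p : Fin J → ℝ) :
    0 ≤ m.rate k θ p := by
  have := m.expUtility_nonneg k θ (p k)
  have := m.denom_pos θ p
  have := m.psi_nonneg k θ (p k)
  unfold rate; positivity

theorem rate_le_psi (m : MixedLogitMarket T J F) (k : Fin J) (θ : T) (p : Fin J → ℝ) :
    m.rate k θ p ≤ m.psi k θ (p k) := by
  unfold rate
  rw [div_le_iff₀ (m.denom_pos θ p)]
  exact mul_le_mul_of_nonneg_left (m.add_expUtility_le_denom k θ p) (m.psi_nonneg k θ _)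

theorem measurable_denom (m : MixedLogitMarket T J F) (p : Fin J → ℝ) :
    Measurable fun θ => m.denom θ p :=
  (Real.measurable_exp.comp m.outside_measurable).add
    (Finset.measurable_fun_sum _ fun k _ => m.measurable_expUtility k (p k))

theorem measurable_logitProb (m : MixedLogitMarket T J F) (j : Fin J) (p : Fin J → ℝ) :
    Measurable fun θ => m.logitProb j θ p :=
  (m.measurable_expUtility j (p j)).div (m.measurable_denom p)

/-- The price derivative of e^u is an a.e. limit of measurable difference quotients, and ψ is
recovered from it by division. -/
theorem aestronglyMeasurable_psi {m : MixedLogitMarket T J F} (hR : ∀ᵐ θ ∂m.μ, m.IsRegular θ)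
    (k : Fin J) {t : ℝ} (ht : 0 < t) : AEStronglyMeasurable (fun θ => m.psi k θ t) m.μ := by
  have hmeas : AEStronglyMeasurable (fun θ => -(m.psi k θ t *
      (Real.exp (m.outside θ) + m.expUtility k θ t))) m.μ := by
    refine aestronglyMeasurable_of_tendsto_ae atTop
      (f := fun (n : ℕ) θ => slope (m.expUtility k θ) t (t + 1 / ((n : ℝ) + 1))) (fun n => ?_) ?_
    · simp only [slope_def_field]
      exact (((m.measurable_expUtility k _).sub
        (m.measurable_expUtility k _)).div_const _).aestronglyMeasurable
    · filter_upwards [hR] with θ hθ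
      refine (hasDerivAt_iff_tendsto_slope.1 (hθ.hasDerivAt k t ht)).comp ?_
      refine tendsto_nhdsWithin_iff.2 ⟨?_, Eventually.of_forall fun n => ?_⟩
      · simpa using tendsto_one_div_add_atTop_nhds_zero_nat.const_add t
      · have : (0 : ℝ) < 1 / ((n : ℝ) + 1) := by positivity
        simp only [Set.mem_compl_iff, Set.mem_singleton_iff]
        linarith
  have hA : Measurable fun θ => Real.exp (m.outside θ) + m.expUtility k θ t :=
    (Real.measurable_exp.comp m.outside_measurable).add (m.measurable_expUtility k t)
  refine (hmeas.aemeasurable.neg.div hA.aemeasurable).aestronglyMeasurable.congr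
    (Eventually.of_forall fun θ => ?_)
  have h1 := m.expUtility_nonneg k θ t
  have h2 := Real.exp_pos (m.outside θ)
  simp only [Pi.div_apply, Pi.neg_apply, neg_neg]
  field_simp

theorem aestronglyMeasurable_rate {m : MixedLogitMarket T J F} (hR : ∀ᵐ θ ∂m.μ, m.IsRegular θ)
    (k : Fin J) {p : Fin J → ℝ} (hp : p ∈ positivePrices J) :
    AEStronglyMeasurable (fun θ => m.rate k θ p) m.μ :=
  (((aestronglyMeasurable_psi hR k (hp k)).aemeasurable.mul
    ((Real.measurable_exp.comp m.outside_measurable).add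
      (m.measurable_expUtility k (p k))).aemeasurable).div
    (m.measurable_denom p).aemeasurable).aestronglyMeasurable

theorem exists_Icc_mem_nhds {p : Fin J → ℝ} (hp : p ∈ positivePrices J) :
    ∃ a b : Fin J → ℝ, a ∈ positivePrices J ∧ Set.Icc a b ∈ 𝓝 p := by
  refine ⟨fun j => p j / 2, fun j => p j + 1, fun j => half_pos (hp j), ?_⟩
  have : Set.Icc (fun j => p j / 2) (fun j => p j + 1)
      = Set.univ.pi fun j => Set.Icc (p j / 2) (p j + 1) := (Set.pi_univ_Icc _ _).symm
  rw [this]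
  exact set_pi_mem_nhds Set.finite_univ fun j _ =>
    Icc_mem_nhds (half_lt_self (hp j)) (lt_add_one _)

theorem mem_positivePrices_of_le {p q : Fin J → ℝ} (hp : p ∈ positivePrices J) (h : p ≤ q) :
    q ∈ positivePrices J := fun j => (hp j).trans_le (h j)

theorem norm_sum_smul_proj_le (c : Fin J → ℝ) {C : ℝ} (hc : ∀ k, |c k| ≤ C) :
    ‖∑ k, c k • (ContinuousLinearMap.proj k : (Fin J → ℝ) →L[ℝ] ℝ)‖ ≤ J * C := by
  refine (norm_sum_le_of_le (n := fun _ => C) _ fun k _ => ?_).trans (by simp)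
  have hC : 0 ≤ C := (abs_nonneg _).trans (hc k)
  refine ContinuousLinearMap.opNorm_le_bound _ hC fun v => ?_
  simp only [_root_.smul_apply, ContinuousLinearMap.proj_apply, smul_eq_mul,
    norm_mul]
  exact mul_le_mul (hc k) (norm_le_pi_norm v k) (norm_nonneg _) hC

/-- Differentiation under the integral sign in the prices. -/
theorem hasFDerivAt_integral_of_le_psi {m : MixedLogitMarket T J F} (hD : m.IsDominated)
    {h : (Fin J → ℝ) → T → ℝ} {h' : (Fin J → ℝ) → Fin J → T → ℝ}
    (hmeas : ∀ q ∈ positivePrices J, AEStronglyMeasurable (h q) m.μ)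
    (hmeas' : ∀ q ∈ positivePrices J, ∀ k, AEStronglyMeasurable (h' q k) m.μ)
    (hle : ∀ θ, ∀ q ∈ positivePrices J, ∀ k, |h' q k θ| ≤ m.psi k θ (q k))
    (hder : ∀ᵐ θ ∂m.μ, ∀ q ∈ positivePrices J, HasFDerivAt (fun q => h q θ)
      (∑ k, h' q k θ • (ContinuousLinearMap.proj k : (Fin J → ℝ) →L[ℝ] ℝ)) q)
    {q₀ : Fin J → ℝ} (hq₀ : q₀ ∈ positivePrices J) (hint : Integrable (h q₀) m.μ)
    {p : Fin J → ℝ} (hp : p ∈ positivePrices J) :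
    Integrable (h p) m.μ ∧ HasFDerivAt (fun q => ∫ θ, h q θ ∂m.μ)
      (∑ k, (∫ θ, h' p k θ ∂m.μ) •
        (ContinuousLinearMap.proj k : (Fin J → ℝ) →L[ℝ] ℝ)) p := by
  -- Integrability spreads from `q₀` to `p` by the mean value inequality on the box spanned by the
  -- two points.
  have hintp : Integrable (h p) m.μ := by
    obtain ⟨Φ, hΦ, hΦle⟩ := hD (p ⊓ q₀) (p ⊔ q₀) fun j => lt_min (hp j) (hq₀ j)
    have hpos : ∀ q ∈ Set.Icc (p ⊓ q₀) (p ⊔ q₀), q ∈ positivePrices J := fun q hq j =>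
      (lt_min (hp j) (hq₀ j)).trans_le (hq.1 j)
    have hdiff : Integrable (fun θ => h p θ - h q₀ θ) m.μ := by
      refine Integrable.mono' ((hΦ.const_mul (J : ℝ)).mul_const ‖p - q₀‖)
        ((hmeas p hp).sub (hmeas q₀ hq₀)) ?_
      filter_upwards [hder, hΦle] with θ hθ hθΦ
      exact (convex_Icc (p ⊓ q₀) (p ⊔ q₀)).norm_image_sub_le_of_norm_hasFDerivWithin_le
        (f := fun q => h q θ) (fun q hq => (hθ q (hpos q hq)).hasFDerivWithinAt)
        (fun q hq => norm_sum_smul_proj_le _ fun k => (hle θ q (hpos q hq) k).trans (hθΦ q hq k))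
        ⟨inf_le_right, le_sup_right⟩ ⟨inf_le_left, le_sup_left⟩
    exact (hdiff.add hint).congr (Eventually.of_forall fun θ => by simp)
  refine ⟨hintp, ?_⟩
  obtain ⟨a, b, ha, hab⟩ := exists_Icc_mem_nhds hp
  obtain ⟨Φ, hΦ, hΦle⟩ := hD a b ha
  have hpos : ∀ q ∈ Set.Icc a b, q ∈ positivePrices J := fun q hq =>
    mem_positivePrices_of_le ha hq.1
  have hint' : ∀ k, Integrable (h' p k) m.μ := fun k =>
    hΦ.mono' (hmeas' p hp k) (hΦle.mono fun θ hθ =>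
      (hle θ p hp k).trans (hθ p (mem_of_mem_nhds hab) k))
  have key := hasFDerivAt_integral_of_dominated_of_fderiv_le (𝕜 := ℝ) (μ := m.μ) (F := h)
    (F' := fun q θ => ∑ k, h' q k θ • (ContinuousLinearMap.proj k : (Fin J → ℝ) →L[ℝ] ℝ))
    (bound := fun θ => J * Φ θ) hab
    (eventually_of_mem hab fun q hq => hmeas q (hpos q hq)) hintp
    (Finset.aestronglyMeasurable_fun_sum _ fun k _ => (hmeas' p hp k).smul_const _)
    (hΦle.mono fun θ hθ q hq =>
      norm_sum_smul_proj_le _ fun k => (hle θ q (hpos q hq) k).trans (hθ q hq k))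
    (hΦ.const_mul _) (hder.mono fun θ hθ q hq => hθ q (hpos q hq))
  rw [integral_finsetSum _ fun k _ => (hint' k).smul_const _] at key
  simpa only [integral_smul_const] using key

theorem integrable_of_abs_le_psi {m : MixedLogitMarket T J F} (hD : m.IsDominated)
    {g : T → ℝ} {k : Fin J} {p : Fin J → ℝ} (hp : p ∈ positivePrices J)
    (hg : AEStronglyMeasurable g m.μ) (hle : ∀ θ, |g θ| ≤ m.psi k θ (p k)) :
    Integrable g m.μ := by
  obtain ⟨Φ, hΦ, hΦle⟩ := hD p p hp
  exact hΦ.mono' hg (hΦle.mono fun θ hθ => (hle θ).trans (hθ p ⟨le_rfl, le_rfl⟩ k))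

theorem continuousAt_integral_of_le_psi {m : MixedLogitMarket T J F} (hD : m.IsDominated)
    {h : (Fin J → ℝ) → T → ℝ} {k : Fin J}
    (hmeas : ∀ q ∈ positivePrices J, AEStronglyMeasurable (h q) m.μ)
    (hle : ∀ θ, ∀ q ∈ positivePrices J, |h q θ| ≤ m.psi k θ (q k))
    {p : Fin J → ℝ} (hp : p ∈ positivePrices J)
    (hcont : ∀ᵐ θ ∂m.μ, ContinuousAt (fun q => h q θ) p) :
    ContinuousAt (fun q => ∫ θ, h q θ ∂m.μ) p := by
  obtain ⟨a, b, ha, hab⟩ := exists_Icc_mem_nhds hp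
  obtain ⟨Φ, hΦ, hΦle⟩ := hD a b ha
  refine continuousAt_of_dominated (bound := Φ)
    (eventually_of_mem hab fun q hq => hmeas q (mem_positivePrices_of_le ha hq.1))
    (eventually_of_mem hab fun q hq => ?_) hΦ hcont
  exact hΦle.mono fun θ hθ => (hle θ q (mem_positivePrices_of_le ha hq.1)).trans (hθ q hq k)

section Pointwise

variable {m : MixedLogitMarket T J F} {θ : T} {p : Fin J → ℝ}

theorem IsRegular.hasFDerivAt_expUtility (hθ : m.IsRegular θ) (hp : p ∈ positivePrices J)
    (k : Fin J) : HasFDerivAt (fun q : Fin J → ℝ => m.expUtility k θ (q k))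
      (-(m.rate k θ p * m.denom θ p) •
        (ContinuousLinearMap.proj k : (Fin J → ℝ) →L[ℝ] ℝ)) p := by
  have h := HasDerivAt.comp_hasFDerivAt (h₂ := m.expUtility k θ) (f := fun q : Fin J → ℝ => q k) p
    (hθ.hasDerivAt k (p k) (hp k))
    (ContinuousLinearMap.proj k : (Fin J → ℝ) →L[ℝ] ℝ).hasFDerivAt
  rw [rate, div_mul_cancel₀ _ (m.denom_pos θ p).ne']
  exact h

theorem IsRegular.hasFDerivAt_denom (hθ : m.IsRegular θ) (hp : p ∈ positivePrices J) :
    HasFDerivAt (m.denom θ) (∑ k, -(m.rate k θ p * m.denom θ p) •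
        (ContinuousLinearMap.proj k : (Fin J → ℝ) →L[ℝ] ℝ)) p :=
  (HasFDerivAt.fun_sum fun k _ => hθ.hasFDerivAt_expUtility hp k).const_add _

theorem IsRegular.hasFDerivAt_log_denom (hθ : m.IsRegular θ) (hp : p ∈ positivePrices J) :
    HasFDerivAt (fun q => Real.log (m.denom θ q)) (∑ k, -m.rate k θ p •
        (ContinuousLinearMap.proj k : (Fin J → ℝ) →L[ℝ] ℝ)) p := by
  refine ((hθ.hasFDerivAt_denom hp).log (m.denom_pos θ p).ne').congr_fderiv ?_
  rw [Finset.smul_sum]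
  refine Finset.sum_congr rfl fun k _ => ?_
  rw [smul_smul]
  congr 1
  have := (m.denom_pos θ p).ne'
  field_simp

theorem IsRegular.hasFDerivAt_logitProb (hθ : m.IsRegular θ) (hp : p ∈ positivePrices J)
    (j : Fin J) : HasFDerivAt (m.logitProb j θ)
      (∑ k, ((m.logitProb j θ p - if j = k then 1 else 0) * m.rate k θ p) •
        (ContinuousLinearMap.proj k : (Fin J → ℝ) →L[ℝ] ℝ)) p := by
  have hne := (m.denom_pos θ p).ne'
  have h := (hθ.hasFDerivAt_expUtility hp j).mul
    ((hasDerivAt_inv hne).comp_hasFDerivAt p (hθ.hasFDerivAt_denom hp))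
  refine HasFDerivAt.congr_fderiv (f := m.logitProb j θ) h ?_
  ext v
  simp only [logitProb_eq_div, _root_.sum_apply, _root_.smul_apply,
    _root_.add_apply, Function.comp_apply, ContinuousLinearMap.proj_apply, smul_eq_mul, sub_mul, ite_mul,
    one_mul, zero_mul, Finset.sum_sub_distrib, Finset.sum_ite_eq, Finset.mem_univ, if_true,
    neg_mul, Finset.sum_neg_distrib]
  have h1 : ∑ k, m.rate k θ p * m.denom θ p * v k = m.denom θ p * ∑ k, m.rate k θ p * v k := by
    rw [Finset.mul_sum]; exact Finset.sum_congr rfl fun k _ => by ring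
  have h2 : ∑ k, m.expUtility j θ (p j) / m.denom θ p * m.rate k θ p * v k
      = m.expUtility j θ (p j) / m.denom θ p * ∑ k, m.rate k θ p * v k := by
    rw [Finset.mul_sum]; exact Finset.sum_congr rfl fun k _ => by ring
  rw [h1, h2]
  field_simp
  ring

theorem IsRegular.continuousAt_rate (hθ : m.IsRegular θ) (hp : p ∈ positivePrices J)
    (k : Fin J) : ContinuousAt (m.rate k θ) p := by
  have h1 : ContinuousAt (fun q : Fin J → ℝ => m.psi k θ (q k)) p :=
    ContinuousAt.comp (f := fun q : Fin J → ℝ => q k)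
      ((hθ.continuousOn_psi k).continuousAt (Ioi_mem_nhds (hp k)))
      (continuous_apply k).continuousAt
  exact (h1.mul ((hθ.hasFDerivAt_expUtility hp k).continuousAt.const_add _)).div
    (hθ.hasFDerivAt_denom hp).continuousAt (m.denom_pos θ p).ne'

end Pointwise

/-! ### The integrals λ and γ, and the derivatives of the choice probabilities. -/

/-- `-λ_k(p)`, the negative of the diagonal entry of `Lam`. -/
noncomputable def lam (m : MixedLogitMarket T J F) (p : Fin J → ℝ) (k : Fin J) : ℝ :=
  ∫ θ, m.rate k θ p ∂m.μ

/-- `-γ_{j,k}(p)`. -/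
noncomputable def gam (m : MixedLogitMarket T J F) (p : Fin J → ℝ) (j k : Fin J) : ℝ :=
  ∫ θ, m.logitProb j θ p * m.rate k θ p ∂m.μ

theorem lam_nonneg (m : MixedLogitMarket T J F) (p : Fin J → ℝ) (k : Fin J) : 0 ≤ m.lam p k :=
  integral_nonneg fun θ => m.rate_nonneg k θ p

theorem gam_nonneg (m : MixedLogitMarket T J F) (p : Fin J → ℝ) (j k : Fin J) :
    0 ≤ m.gam p j k :=
  integral_nonneg fun θ => mul_nonneg (m.logitProb_nonneg j θ p) (m.rate_nonneg k θ p)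

theorem integrable_logitProb (m : MixedLogitMarket T J F) (j : Fin J) (p : Fin J → ℝ) :
    Integrable (fun θ => m.logitProb j θ p) m.μ := by
  have := m.isProbabilityMeasure
  refine Integrable.of_bound (m.measurable_logitProb j p).aestronglyMeasurable 1
    (Eventually.of_forall fun θ => ?_)
  rw [Real.norm_of_nonneg (m.logitProb_nonneg j θ p)]
  exact m.logitProb_le_one j θ p

theorem prob_le_one (m : MixedLogitMarket T J F) (p : Fin J → ℝ) (j : Fin J) :
    m.prob p j ≤ 1 := by
  have := m.isProbabilityMeasure
  have h := integral_mono (m.integrable_logitProb j p) (integrable_const (1 : ℝ))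
    (fun θ => m.logitProb_le_one j θ p)
  simpa [prob] using h

theorem prob_nonneg (m : MixedLogitMarket T J F) (p : Fin J → ℝ) (j : Fin J) :
    0 ≤ m.prob p j := integral_nonneg fun θ => m.logitProb_nonneg j θ p

theorem not_ae_reservation_le {m : MixedLogitMarket T J F} (htop : m.maxReservation = ⊤) (b : ℝ) :
    ¬ ∀ᵐ θ ∂m.μ, m.reservation θ ≤ ENNReal.ofReal b := by
  intro h
  have : m.maxReservation ≤ ENNReal.ofReal b := essSup_le_of_ae_le _ h
  rw [htop, top_le_iff] at this
  exact ENNReal.ofReal_ne_top this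

theorem hasDerivAt_comp_update {f : (Fin J → ℝ) → ℝ} {c : Fin J → ℝ} {p : Fin J → ℝ} {k : Fin J}
    {t : ℝ} (hf : HasFDerivAt f
      (∑ k, c k • (ContinuousLinearMap.proj k : (Fin J → ℝ) →L[ℝ] ℝ)) (Function.update p k t)) :
    HasDerivAt (fun s => f (Function.update p k s)) (c k) t := by
  refine (hf.comp_hasDerivAt t (hasDerivAt_update p k t)).congr_deriv ?_
  simp [Pi.single_apply]

theorem update_mem_positivePrices {p : Fin J → ℝ} (hp : p ∈ positivePrices J) (k : Fin J) {t : ℝ}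
    (ht : 0 < t) : Function.update p k t ∈ positivePrices J := by
  intro j
  rcases eq_or_ne j k with rfl | h
  · simpa
  · simpa [h] using hp j

section

variable {m : MixedLogitMarket T J F} (hR : ∀ᵐ θ ∂m.μ, m.IsRegular θ) (hD : m.IsDominated)
  {p : Fin J → ℝ} (hp : p ∈ positivePrices J)

include hR hD hp

theorem integrable_rate (k : Fin J) : Integrable (fun θ => m.rate k θ p) m.μ :=
  integrable_of_abs_le_psi hD hp (aestronglyMeasurable_rate hR k hp) fun θ => by
    rw [abs_of_nonneg (m.rate_nonneg k θ p)]; exact m.rate_le_psi k θ p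

omit hD in
theorem aestronglyMeasurable_logitProb_mul_rate (j k : Fin J) :
    AEStronglyMeasurable (fun θ => m.logitProb j θ p * m.rate k θ p) m.μ :=
  (m.measurable_logitProb j p).aestronglyMeasurable.mul (aestronglyMeasurable_rate hR k hp)

omit hR hD hp in
theorem abs_logitProb_mul_rate_le (j k : Fin J) (θ : T) :
    |m.logitProb j θ p * m.rate k θ p| ≤ m.psi k θ (p k) := by
  rw [abs_of_nonneg (mul_nonneg (m.logitProb_nonneg j θ p) (m.rate_nonneg k θ p))]
  exact (mul_le_of_le_one_left (m.rate_nonneg k θ p) (m.logitProb_le_one j θ p)).trans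
    (m.rate_le_psi k θ p)

theorem integrable_logitProb_mul_rate (j k : Fin J) :
    Integrable (fun θ => m.logitProb j θ p * m.rate k θ p) m.μ :=
  integrable_of_abs_le_psi hD hp (aestronglyMeasurable_logitProb_mul_rate hR hp j k)
    (abs_logitProb_mul_rate_le j k)

theorem hasFDerivAt_prob (j : Fin J) : HasFDerivAt (fun q => m.prob q j)
    (∑ k, (m.gam p j k - if j = k then m.lam p k else 0) •
      (ContinuousLinearMap.proj k : (Fin J → ℝ) →L[ℝ] ℝ)) p := by
  have key := (hasFDerivAt_integral_of_le_psi hD (h := fun q θ => m.logitProb j θ q)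
    (h' := fun q k θ => (m.logitProb j θ q - if j = k then 1 else 0) * m.rate k θ q)
    (fun q _ => (m.measurable_logitProb j q).aestronglyMeasurable)
    (fun q hq k => ((m.measurable_logitProb j q).sub_const _).aestronglyMeasurable.mul
      (aestronglyMeasurable_rate hR k hq))
    (fun θ q _ k => by
      rw [abs_mul, abs_of_nonneg (m.rate_nonneg k θ q)]
      refine (mul_le_of_le_one_left (m.rate_nonneg k θ q) ?_).trans (m.rate_le_psi k θ q)
      have h0 := m.logitProb_nonneg j θ q
      have h1 := m.logitProb_le_one j θ q
      rw [abs_le]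
      split_ifs <;> constructor <;> linarith)
    (hR.mono fun θ hθ q hq => hθ.hasFDerivAt_logitProb hq j) hp (m.integrable_logitProb j p) hp).2
  refine key.congr_fderiv (Finset.sum_congr rfl fun k _ => ?_)
  congr 1
  simp only [sub_mul, ite_mul, one_mul, zero_mul]
  have hI := integrable_logitProb_mul_rate hR hD hp j k
  by_cases hjk : j = k
  · simp only [hjk, if_true]
    rw [hjk] at hI
    exact integral_sub hI (integrable_rate hR hD hp k)
  · simp [hjk, gam]

theorem continuousAt_prob (j : Fin J) : ContinuousAt (fun q => m.prob q j) p :=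
  (hasFDerivAt_prob hR hD hp j).continuousAt

theorem continuousAt_lam (k : Fin J) : ContinuousAt (fun q => m.lam q k) p :=
  continuousAt_integral_of_le_psi hD (fun _ hq => aestronglyMeasurable_rate hR k hq)
    (fun θ q _ => by rw [abs_of_nonneg (m.rate_nonneg k θ q)]; exact m.rate_le_psi k θ q) hp
    (hR.mono fun θ hθ => hθ.continuousAt_rate hp k)

theorem continuousAt_gam (j k : Fin J) : ContinuousAt (fun q => m.gam q j k) p :=
  continuousAt_integral_of_le_psi hD
    (fun _ hq => aestronglyMeasurable_logitProb_mul_rate hR hq j k)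
    (fun θ _ _ => abs_logitProb_mul_rate_le j k θ) hp
    (hR.mono fun _ hθ =>
      (hθ.hasFDerivAt_logitProb hp j).continuousAt.mul (hθ.continuousAt_rate hp k))

omit hD in
theorem prob_pos (htop : m.maxReservation = ⊤) (j : Fin J) : 0 < m.prob p j := by
  refine (m.prob_nonneg p j).lt_of_ne' fun h => not_ae_reservation_le htop (p j) ?_
  have h0 := (integral_eq_zero_iff_of_nonneg (fun θ => m.logitProb_nonneg j θ p)
    (m.integrable_logitProb j p)).1 h
  filter_upwards [hR, h0] with θ hθ hθ0
  by_contra! hlt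
  have hpos := hθ.expUtility_pos j (p j) (hp j) hlt
  exact (div_pos hpos (m.denom_pos θ p)).ne' hθ0

theorem ae_psi_eq_zero_of_lam_eq_zero {k : Fin J} (h : m.lam p k = 0) :
    ∀ᵐ θ ∂m.μ, m.psi k θ (p k) = 0 := by
  have h0 := (integral_eq_zero_iff_of_nonneg (fun θ => m.rate_nonneg k θ p) (integrable_rate hR hD hp k)).1 h
  filter_upwards [h0] with θ hθ
  have hA : 0 < Real.exp (m.outside θ) + m.expUtility k θ (p k) :=
    add_pos_of_pos_of_nonneg (Real.exp_pos _) (m.expUtility_nonneg k θ _)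
  have : m.rate k θ p = 0 := hθ
  rw [rate, div_eq_zero_iff, mul_eq_zero] at this
  rcases this with (h | h) | h
  · exact h
  · exact absurd h hA.ne'
  · exact absurd h (m.denom_pos θ p).ne'

omit hR hD hp in
-- This identifies the restricted integrals in `Lam` and `intraGam` with integrals over the whole
-- population.
theorem IsRegular.rate_eq {θ : T} (hθ : m.IsRegular θ) (hp : p ∈ positivePrices J) (k : Fin J) :
    m.rate k θ p = if ENNReal.ofReal (p k) < m.reservation θ then
      -(m.dw k θ (p k) * m.logitProb k θ p) else 0 := by
  split_ifs with h
  · rw [logitProb_eq_div, ← mul_div_assoc, hθ.dw_mul k (p k) (hp k) h, rate]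
    ring
  · rw [rate, m.psi_of_le (not_lt.1 h)]; simp

omit hD in
theorem Lam_eq : m.Lam p = Matrix.diagonal fun k => -m.lam p k := by
  unfold Lam
  congr 1
  ext k
  have hmeas : MeasurableSet {θ | ENNReal.ofReal (p k) < m.reservation θ} :=
    measurableSet_lt measurable_const m.reservation_measurable
  rw [← integral_indicator hmeas, lam, ← integral_neg]
  refine integral_congr_ae ?_
  filter_upwards [hR] with θ hθ
  rw [hθ.rate_eq hp k, Set.indicator_apply]
  simp only [Set.mem_ofPred_eq]
  split_ifs <;> simp

omit hD in
theorem intraGam_eq : m.intraGam p =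
    Matrix.of fun j k => if m.firm j = m.firm k then -m.gam p j k else 0 := by
  unfold intraGam
  congr 1
  ext j k
  refine if_congr Iff.rfl ?_ rfl
  have hmeas : MeasurableSet {θ | ENNReal.ofReal (p j) < m.reservation θ ∧
      ENNReal.ofReal (p k) < m.reservation θ} :=
    (measurableSet_lt measurable_const m.reservation_measurable).inter
      (measurableSet_lt measurable_const m.reservation_measurable)
  rw [← integral_indicator hmeas, gam, ← integral_neg]
  refine integral_congr_ae ?_
  filter_upwards [hR] with θ hθ
  rw [hθ.rate_eq hp k, Set.indicator_apply]
  simp only [Set.mem_ofPred_eq]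
  by_cases hj : ENNReal.ofReal (p j) < m.reservation θ
  · by_cases hk : ENNReal.ofReal (p k) < m.reservation θ
    · simp only [hj, hk, and_self, if_true]; ring
    · simp [hk]
  · have : m.logitProb j θ p = 0 := by
      rw [logitProb_eq_div, hθ.expUtility_eq_zero j (p j) (hp j) (not_lt.1 hj), zero_div]
    simp [hj, this]

end

/-! ### The boundedness assumption as inequalities between P, λ and γ. -/

section

variable {m : MixedLogitMarket T J F} (hR : ∀ᵐ θ ∂m.μ, m.IsRegular θ) (hD : m.IsDominated)
  (htop : m.maxReservation = ⊤)

include hR htop in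
-- Otherwise e^u would be constant on the interval for individuals with reservation price above `b`,
-- against strict monotonicity; they have positive mass.
theorem exists_not_ae_psi_eq_zero (k : Fin J) {a b : ℝ} (ha : 0 < a) (hab : a < b) :
    ∃ t ∈ Set.Ioo a b, ¬ ∀ᵐ θ ∂m.μ, m.psi k θ t = 0 := by
  by_contra! hall
  refine not_ae_reservation_le htop b ?_
  have hq : ∀ᵐ θ ∂m.μ, ∀ r : ℚ, (r : ℝ) ∈ Set.Ioo a b → m.psi k θ r = 0 :=
    ae_all_iff.2 fun r => by
      by_cases hr : (r : ℝ) ∈ Set.Ioo a b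
      · exact (hall r hr).mono fun _ h _ => h
      · exact Eventually.of_forall fun _ h => absurd h hr
  filter_upwards [hR, hq] with θ hθ hθq
  by_contra! hlt
  have hzero : ∀ t ∈ Set.Ioo a b, m.psi k θ t = 0 := by
    intro t ht
    by_contra hne
    have hev : {x | m.psi k θ x ≠ 0} ∩ Set.Ioo a b ∈ 𝓝 t :=
      inter_mem (((hθ.continuousOn_psi k).continuousAt
        (Ioi_mem_nhds (ha.trans ht.1))).eventually_ne hne) (Ioo_mem_nhds ht.1 ht.2)
    obtain ⟨r, hr1, hr2⟩ := (Rat.denseRange_cast (𝕜 := ℝ)).mem_nhds hev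
    exact hr1 (hθq r hr2)
  have hd : ∀ t, a ≤ t → HasDerivAt (m.expUtility k θ)
      (-(m.psi k θ t * (Real.exp (m.outside θ) + m.expUtility k θ t))) t :=
    fun t ht => hθ.hasDerivAt k t (ha.trans_le ht)
  obtain ⟨c, hc, hslope⟩ := exists_hasDerivAt_eq_slope (m.expUtility k θ) _ hab
    (fun t ht => (hd t ht.1).continuousAt.continuousWithinAt) (fun t ht => hd t ht.1.le)
  rw [hzero c hc, zero_mul, neg_zero, eq_comm, div_eq_zero_iff] at hslope
  have hanti := hθ.strictAntiOn k
    ⟨ha, (ENNReal.ofReal_le_ofReal hab.le).trans_lt hlt⟩ ⟨ha.trans hab, hlt⟩ hab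
  rcases hslope with h | h <;> linarith

include hR in
theorem inv_Lam_eq {p : Fin J → ℝ} (hp : p ∈ positivePrices J) (hpos : ∀ k, 0 < m.lam p k) :
    (m.Lam p)⁻¹ = Matrix.diagonal fun k => -(m.lam p k)⁻¹ := by
  refine Matrix.inv_eq_right_inv ?_
  rw [Lam_eq hR hp, Matrix.diagonal_mul_diagonal, ← Matrix.diagonal_one]
  congr 1
  ext k
  simp [(hpos k).ne']

include hR hD htop in
-- Where some λ_k vanishes, `(m.Lam p)⁻¹` is 0 by convention and the assumed bound is empty. Such
-- prices are limits of prices at which no λ_k vanishes, and the inequality passes to the limit by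
-- continuity.
theorem prob_le_mul_lam {M : ℝ}
    (hM : ∀ p ∈ positivePrices J, ‖(m.Lam p)⁻¹ *ᵥ m.prob p‖ ≤ M)
    {p : Fin J → ℝ} (hp : p ∈ positivePrices J) (j : Fin J) : m.prob p j ≤ M * m.lam p j := by
  have hgood : ∀ q ∈ positivePrices J, (∀ k, m.lam q k ≠ 0) → m.prob q j ≤ M * m.lam q j := by
    intro q hq hne
    have h := (norm_le_pi_norm ((m.Lam q)⁻¹ *ᵥ m.prob q) j).trans (hM q hq)
    have hpos : ∀ k, 0 < m.lam q k := fun k => (m.lam_nonneg q k).lt_of_ne' (hne k)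
    rw [inv_Lam_eq hR hq hpos, Matrix.mulVec_diagonal, neg_mul, norm_neg, norm_mul, norm_inv,
      Real.norm_of_nonneg (hpos j).le, Real.norm_of_nonneg (m.prob_nonneg q j),
      inv_mul_le_iff₀ (hpos j)] at h
    linarith
  have hex : ∀ n : ℕ, ∃ q ∈ positivePrices J, (∀ k, m.lam q k ≠ 0) ∧
      ∀ k, q k ∈ Set.Ioo (p k) (p k + 1 / ((n : ℝ) + 1)) := by
    intro n
    have hn : (0 : ℝ) < 1 / ((n : ℝ) + 1) := by positivity
    choose q hq hq' using fun k =>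
      exists_not_ae_psi_eq_zero hR htop k (hp k) (lt_add_of_pos_right (p k) hn)
    have hqpos : q ∈ positivePrices J := fun k => (hp k).trans (hq k).1
    exact ⟨q, hqpos, fun k h => hq' k
      (ae_psi_eq_zero_of_lam_eq_zero hR hD hqpos h), hq⟩
  choose q hqpos hqne hq using hex
  have hlim : Tendsto q atTop (𝓝 p) := by
    refine tendsto_pi_nhds.2 fun k => ?_
    refine tendsto_of_tendsto_of_tendsto_of_le_of_le tendsto_const_nhds ?_
      (fun n => (hq n k).1.le) (fun n => (hq n k).2.le)
    simpa using tendsto_one_div_add_atTop_nhds_zero_nat.const_add (p k)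
  exact le_of_tendsto_of_tendsto' ((continuousAt_prob hR hD hp j).tendsto.comp hlim)
    (((continuousAt_lam hR hD hp j).tendsto.comp hlim).const_mul M)
    fun n => hgood (q n) (hqpos n) (hqne n)

theorem sum_abs_le_matrixNorm (A : Matrix (Fin J) (Fin J) ℝ) (j : Fin J) :
    ∑ k, |A j k| ≤ matrixNorm A := by
  have h : matrixNorm A = ((Finset.univ.sup fun i => ∑ k, ‖A i k‖₊ : NNReal) : ℝ) :=
    Matrix.linfty_opNorm_def A
  rw [h]
  have : (∑ k, ‖A j k‖₊) ≤ Finset.univ.sup fun i => ∑ k, ‖A i k‖₊ :=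
    Finset.le_sup (f := fun i => ∑ k, ‖A i k‖₊) (Finset.mem_univ j)
  have h2 : ((∑ k, ‖A j k‖₊ : NNReal) : ℝ) = ∑ k, |A j k| := by simp
  rw [← h2]
  exact_mod_cast this

include hR in
-- All entries of Ω̃ are nonnegative here, so its absolute row sums are these sums divided by λ_j.
theorem sum_gam_le {p : Fin J → ℝ} (hp : p ∈ positivePrices J) (hpos : ∀ k, 0 < m.lam p k)
    {c : ℝ} (hc : matrixNorm (m.intraOmega p) ≤ c) (j : Fin J) :
    ∑ k with m.firm k = m.firm j, m.gam p k j ≤ c * m.lam p j := by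
  have h := (sum_abs_le_matrixNorm (m.intraOmega p) j).trans hc
  have hentry : ∀ k, |m.intraOmega p j k|
      = (m.lam p j)⁻¹ * if m.firm k = m.firm j then m.gam p k j else 0 := by
    intro k
    have hnn : 0 ≤ (m.lam p j)⁻¹ * if m.firm k = m.firm j then m.gam p k j else 0 :=
      mul_nonneg (inv_nonneg.2 (hpos j).le) (by split_ifs; exacts [m.gam_nonneg p k j, le_rfl])
    rw [intraOmega, inv_Lam_eq hR hp hpos, Matrix.diagonal_mul, Matrix.transpose_apply,
      intraGam_eq hR hp, Matrix.of_apply, ← abs_of_nonneg hnn]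
    congr 1
    split_ifs <;> simp
  rw [Finset.sum_congr rfl fun k _ => hentry k, ← Finset.mul_sum, inv_mul_le_iff₀ (hpos j),
    ← Finset.sum_filter] at h
  linarith

end

/-! ### Behaviour at small prices. -/

theorem IsRegular.antitoneOn_expUtility {m : MixedLogitMarket T J F} {θ : T}
    (hθ : m.IsRegular θ) (k : Fin J) : AntitoneOn (m.expUtility k θ) (Set.Ioi 0) := by
  refine antitoneOn_of_deriv_nonpos (convex_Ioi 0)
    (fun t ht => (hθ.hasDerivAt k t ht).continuousAt.continuousWithinAt) ?_ ?_
  · rw [interior_Ioi]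
    exact fun t ht => (hθ.hasDerivAt k t ht).differentiableAt.differentiableWithinAt
  · rw [interior_Ioi]
    intro t ht
    rw [(hθ.hasDerivAt k t ht).deriv, neg_nonpos]
    exact mul_nonneg (m.psi_nonneg k θ t)
      (add_nonneg (Real.exp_pos _).le (m.expUtility_nonneg k θ t))

theorem IsRegular.denom_le_denom {m : MixedLogitMarket T J F} {θ : T} (hθ : m.IsRegular θ)
    {p q : Fin J → ℝ} (hp : p ∈ positivePrices J) (hpq : p ≤ q) :
    m.denom θ q ≤ m.denom θ p := by
  unfold denom
  gcongr with k _
  exact hθ.antitoneOn_expUtility k (hp k) ((hp k).trans_le (hpq k)) (hpq k)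

section

variable {m : MixedLogitMarket T J F} (hR : ∀ᵐ θ ∂m.μ, m.IsRegular θ) (hD : m.IsDominated)
  {c : ℝ} (hc : c < 1)
  (hgam : ∀ p ∈ positivePrices J, ∀ k, m.gam p k k ≤ c * m.lam p k)

include hR hD

theorem hasDerivAt_prob_update {p : Fin J → ℝ} (hp : p ∈ positivePrices J) (j k : Fin J) {t : ℝ}
    (ht : 0 < t) : HasDerivAt (fun s => m.prob (Function.update p k s) j)
      (m.gam (Function.update p k t) j k -
        if j = k then m.lam (Function.update p k t) k else 0) t :=
  hasDerivAt_comp_update (hasFDerivAt_prob hR hD (update_mem_positivePrices hp k ht) j)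

include hgam

/-- In the k-th price, (1 - c) times the integral has derivative -(1 - c) λ_k, and P_k has
derivative γ_{kk} - λ_k, which is no larger. Their difference is monotone, and P_k takes values in
[0, 1]. -/
theorem mul_integral_log_denom_sub_le {p : Fin J → ℝ} (hp : p ∈ positivePrices J)
    (k : Fin J) {t : ℝ} (ht : 0 < t) (htp : t ≤ p k) :
    Integrable (fun θ => Real.log (m.denom θ (Function.update p k t)) - Real.log (m.denom θ p))
      m.μ ∧
    (1 - c) * ∫ θ, (Real.log (m.denom θ (Function.update p k t)) - Real.log (m.denom θ p)) ∂m.μ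
      ≤ 1 := by
  have key : ∀ q ∈ positivePrices J, _ := fun q hq =>
    hasFDerivAt_integral_of_le_psi hD (q₀ := p) (p := q)
    (h := fun q θ => Real.log (m.denom θ q) - Real.log (m.denom θ p))
    (h' := fun q k θ => -m.rate k θ q)
    (fun q _ => ((Real.measurable_log.comp (m.measurable_denom q)).sub
      (Real.measurable_log.comp (m.measurable_denom p))).aestronglyMeasurable)
    (fun q hq k => (aestronglyMeasurable_rate hR k hq).neg)
    (fun θ q _ k => by
      rw [abs_neg, abs_of_nonneg (m.rate_nonneg k θ q)]; exact m.rate_le_psi k θ q)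
    (hR.mono fun θ hθ q hq => (hθ.hasFDerivAt_log_denom hq).sub_const _) hp (by simp) hq
  refine ⟨(key _ (update_mem_positivePrices hp k ht)).1, ?_⟩
  let L : ℝ → ℝ := fun s =>
    ∫ θ, (Real.log (m.denom θ (Function.update p k s)) - Real.log (m.denom θ p)) ∂m.μ
  have hder : ∀ s, 0 < s → HasDerivAt
      (fun s => (1 - c) * L s - m.prob (Function.update p k s) k)
      ((1 - c) * -m.lam (Function.update p k s) k -
        (m.gam (Function.update p k s) k k - m.lam (Function.update p k s) k)) s := by
    intro s hs
    have h1 := hasDerivAt_comp_update (key _ (update_mem_positivePrices hp k hs)).2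
    rw [integral_neg] at h1
    have h2 := hasDerivAt_prob_update hR hD hp k k hs
    rw [if_pos rfl] at h2
    exact (h1.const_mul (1 - c)).sub h2
  have hmono : MonotoneOn (fun s => (1 - c) * L s - m.prob (Function.update p k s) k)
      (Set.Ioi 0) := by
    refine monotoneOn_of_deriv_nonneg (convex_Ioi 0)
      (fun s hs => (hder s hs).continuousAt.continuousWithinAt) ?_ ?_
    · rw [interior_Ioi]
      exact fun s hs => (hder s hs).differentiableAt.differentiableWithinAt
    · rw [interior_Ioi]
      intro s hs
      rw [(hder s hs).deriv]
      linarith [hgam _ (update_mem_positivePrices hp k hs) k]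
  have h := hmono ht (hp k) htp
  have hL0 : L (p k) = 0 := by simp [L]
  simp only [hL0] at h
  have h1 := m.prob_le_one (Function.update p k t) k
  have h2 := m.prob_nonneg (Function.update p k (p k)) k
  change (1 - c) * L t ≤ 1
  linarith

include hc

/-- Monotone convergence along prices 1/(n+1) makes the supremum of the log-denominators finite
almost everywhere. -/
theorem ae_bddAbove_expUtility (k : Fin J) :
    ∀ᵐ θ ∂m.μ, BddAbove (Set.range fun n : ℕ => m.expUtility k θ (1 / ((n : ℝ) + 1))) := by
  let p : Fin J → ℝ := fun _ => 1
  have hp : p ∈ positivePrices J := fun _ => one_pos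
  have hn : ∀ n : ℕ, (0 : ℝ) < 1 / ((n : ℝ) + 1) := fun n => by positivity
  have hn1 : ∀ n : ℕ, 1 / ((n : ℝ) + 1) ≤ 1 := fun n => by
    rw [div_le_one (by positivity)]; linarith [n.cast_nonneg (α := ℝ)]
  let f : ℕ → T → ℝ := fun n θ =>
    Real.log (m.denom θ (Function.update p k (1 / ((n : ℝ) + 1)))) - Real.log (m.denom θ p)
  have hmeas : ∀ n, Measurable (f n) := fun n =>
    (Real.measurable_log.comp (m.measurable_denom _)).sub
      (Real.measurable_log.comp (m.measurable_denom p))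
  have hpos : ∀ᵐ θ ∂m.μ, ∀ n, 0 ≤ f n θ := by
    filter_upwards [hR] with θ hθ n
    refine sub_nonneg.2 (Real.log_le_log (m.denom_pos θ _) ?_)
    exact hθ.denom_le_denom (update_mem_positivePrices hp k (hn n))
      (update_le_self_iff.2 (hn1 n))
  have hmono : ∀ᵐ θ ∂m.μ, Monotone fun n => ENNReal.ofReal (f n θ) := by
    filter_upwards [hR] with θ hθ n n' hnn
    refine ENNReal.ofReal_le_ofReal (sub_le_sub_right (Real.log_le_log (m.denom_pos θ _) ?_) _)
    refine hθ.denom_le_denom (update_mem_positivePrices hp k (hn n')) ?_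
    rw [update_le_update_iff']
    exact one_div_le_one_div_of_le (by positivity) (by gcongr)
  have hint : ∫⁻ θ, ⨆ n, ENNReal.ofReal (f n θ) ∂m.μ ≤ ENNReal.ofReal (1 / (1 - c)) := by
    rw [lintegral_iSup' (fun n => (hmeas n).ennreal_ofReal.aemeasurable) hmono]
    refine iSup_le fun n => ?_
    obtain ⟨h1, h2⟩ := mul_integral_log_denom_sub_le hR hD hgam hp k (hn n) (hn1 n)
    rw [← ofReal_integral_eq_lintegral_ofReal h1 (hpos.mono fun θ h => h n)]
    refine ENNReal.ofReal_le_ofReal ?_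
    rw [le_div_iff₀ (sub_pos.2 hc)]
    linarith
  have hfin := ae_lt_top' (AEMeasurable.iSup fun n => (hmeas n).ennreal_ofReal.aemeasurable)
    (hint.trans_lt ENNReal.ofReal_lt_top).ne
  filter_upwards [hfin] with θ hθ
  refine ⟨Real.exp ((⨆ n, ENNReal.ofReal (f n θ)).toReal) * m.denom θ p, ?_⟩
  rintro _ ⟨n, rfl⟩
  have h1 : f n θ ≤ (⨆ n, ENNReal.ofReal (f n θ)).toReal :=
    (ENNReal.ofReal_le_iff_le_toReal hθ.ne).1 (le_iSup (fun n => ENNReal.ofReal (f n θ)) n)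
  have h2 : m.denom θ (Function.update p k (1 / ((n : ℝ) + 1))) = Real.exp (f n θ) * m.denom θ p := by
    simp only [f]
    rw [Real.exp_sub, Real.exp_log (m.denom_pos θ _), Real.exp_log (m.denom_pos θ _),
      div_mul_cancel₀ _ (m.denom_pos θ p).ne']
  have h3 := m.add_expUtility_le_denom k θ (Function.update p k (1 / ((n : ℝ) + 1)))
  rw [Function.update_self] at h3
  have h4 := Real.exp_pos (m.outside θ)
  calc m.expUtility k θ (1 / ((n : ℝ) + 1)) ≤ Real.exp (f n θ) * m.denom θ p := by
        rw [← h2]; linarith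
    _ ≤ _ := by
        have := m.denom_pos θ p
        gcongr

/-- Choice probabilities are bounded below uniformly in the prices of the other products. -/
theorem exists_pos_le_prob (htop : m.maxReservation = ⊤) (j : Fin J) :
    ∃ a : ℝ, 0 < a ∧ ∀ p ∈ positivePrices J, p j ≤ 1 → a ≤ m.prob p j := by
  let S : Fin J → T → ℝ := fun k θ => ⨆ n : ℕ, m.expUtility k θ (1 / ((n : ℝ) + 1))
  have hSmeas : ∀ k, Measurable (S k) := fun k =>
    Measurable.iSup fun n => m.measurable_expUtility k _
  have hS0 : ∀ k θ, 0 ≤ S k θ := fun k θ => Real.iSup_nonneg fun n => m.expUtility_nonneg k θ _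
  have hS : ∀ᵐ θ ∂m.μ, ∀ k, ∀ t, 0 < t → m.expUtility k θ t ≤ S k θ := by
    filter_upwards [hR, ae_all_iff.2 (ae_bddAbove_expUtility hR hD hc hgam)] with θ hθ hb k t ht
    obtain ⟨n, hn⟩ := exists_nat_one_div_lt ht
    have hn0 : (0 : ℝ) < 1 / ((n : ℝ) + 1) := by positivity
    exact (hθ.antitoneOn_expUtility k hn0 ht hn.le).trans (le_ciSup (hb k) n)
  have hden : ∀ θ, 0 < Real.exp (m.outside θ) + ∑ k, S k θ := fun θ =>
    add_pos_of_pos_of_nonneg (Real.exp_pos _) (Finset.sum_nonneg fun k _ => hS0 k θ)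
  -- The worst case for product j: its own price is 1 and every term of the denominator is at its
  -- supremum.
  let g : T → ℝ := fun θ => m.expUtility j θ 1 / (Real.exp (m.outside θ) + ∑ k, S k θ)
  have hg0 : ∀ θ, 0 ≤ g θ := fun θ => div_nonneg (m.expUtility_nonneg j θ 1) (hden θ).le
  have hgmeas : Measurable g := (m.measurable_expUtility j 1).div
    ((Real.measurable_exp.comp m.outside_measurable).add
      (Finset.measurable_fun_sum _ fun k _ => hSmeas k))
  have hgle : ∀ p ∈ positivePrices J, p j ≤ 1 → ∀ᵐ θ ∂m.μ, g θ ≤ m.logitProb j θ p := by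
    intro p hp hpj
    filter_upwards [hR, hS] with θ hθ hSθ
    refine div_le_div₀ (m.expUtility_nonneg j θ _)
      (hθ.antitoneOn_expUtility j (hp j) (Set.mem_Ioi.2 one_pos) hpj) (m.denom_pos θ p) ?_
    gcongr with k _
    exact hSθ k (p k) (hp k)
  have hone : (fun _ => 1 : Fin J → ℝ) ∈ positivePrices J := fun _ => one_pos
  have hgint : Integrable g m.μ := (m.integrable_logitProb j fun _ => 1).mono'
    hgmeas.aestronglyMeasurable ((hgle _ hone le_rfl).mono fun θ h => by
      rwa [Real.norm_of_nonneg (hg0 θ)])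
  refine ⟨∫ θ, g θ ∂m.μ, ?_, fun p hp hpj =>
    integral_mono_ae hgint (m.integrable_logitProb j p) (hgle p hp hpj)⟩
  refine (integral_nonneg hg0).lt_of_ne' fun h => not_ae_reservation_le htop 1 ?_
  have h0 := (integral_eq_zero_iff_of_nonneg hg0 hgint).1 h
  filter_upwards [hR, h0] with θ hθ hθ0
  by_contra! hlt
  exact (div_pos (hθ.expUtility_pos j 1 one_pos hlt) (hden θ)).ne' hθ0

omit hc in
-- If λ_k > a/t on (0, 1], then P_k + (1 - c) a log t is antitone there, and P_k would be unbounded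
-- near 0.
theorem exists_mul_lam_update_le {p : Fin J → ℝ} (hp : p ∈ positivePrices J) (k : Fin J)
    (hc : c < 1) {a : ℝ} (ha : 0 < a) :
    ∃ t, 0 < t ∧ t ≤ 1 ∧ t * m.lam (Function.update p k t) k ≤ a := by
  by_contra! hall
  have hder : ∀ s, 0 < s → HasDerivAt
      (fun s => m.prob (Function.update p k s) k + (1 - c) * a * Real.log s)
      (m.gam (Function.update p k s) k k - m.lam (Function.update p k s) k
        + (1 - c) * a * s⁻¹) s := by
    intro s hs
    have h2 := hasDerivAt_prob_update hR hD hp k k hs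
    rw [if_pos rfl] at h2
    exact h2.add ((Real.hasDerivAt_log hs.ne').const_mul _)
  have hanti : AntitoneOn (fun s => m.prob (Function.update p k s) k + (1 - c) * a * Real.log s)
      (Set.Ioc 0 1) := by
    refine antitoneOn_of_deriv_nonpos (convex_Ioc 0 1)
      (fun s hs => (hder s hs.1).continuousAt.continuousWithinAt) ?_ ?_
    · rw [interior_Ioc]
      exact fun s hs => (hder s hs.1).differentiableAt.differentiableWithinAt
    · rw [interior_Ioc]
      intro s hs
      rw [(hder s hs.1).deriv]
      have h1 := hgam _ (update_mem_positivePrices hp k hs.1) k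
      have h2 : a * s⁻¹ ≤ m.lam (Function.update p k s) k := by
        rw [← div_eq_mul_inv, div_le_iff₀ hs.1]
        linarith [hall s hs.1 hs.2.le]
      have h3 := mul_le_mul_of_nonneg_left h2 (sub_nonneg.2 hc.le)
      linarith
  have hca : 0 < (1 - c) * a := mul_pos (sub_pos.2 hc) ha
  -- At this price the logarithmic term equals -2, which would force P_k ≥ 2.
  have ht1 : Real.exp (-(2 / ((1 - c) * a))) ≤ 1 := Real.exp_le_one_iff.2 (by
    have := div_pos two_pos hca
    linarith)
  have h := hanti ⟨Real.exp_pos _, ht1⟩ ⟨one_pos, le_rfl⟩ ht1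
  simp only [Real.log_one, mul_zero, add_zero, Real.log_exp] at h
  have h1 := m.prob_le_one (Function.update p k (Real.exp (-(2 / ((1 - c) * a))))) k
  have h2 := m.prob_nonneg (Function.update p k 1) k
  have h3 : (1 - c) * a * -(2 / ((1 - c) * a)) = -2 := by
    rw [mul_neg, mul_div_cancel₀ _ hca.ne']
  linarith

/-- There are arbitrarily small prices of product `j` at which it is profitable to raise the
price, whatever the prices of the other products below a given bound. -/
theorem exists_mul_lam_le_prob (htop : m.maxReservation = ⊤) {b : Fin J → ℝ}
    (hb : b ∈ positivePrices J) (j : Fin J) :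
    ∃ t, 0 < t ∧ t ≤ 1 ∧ ∀ p ∈ positivePrices J, p ≤ b → p j = t →
      t * m.lam p j ≤ m.prob p j := by
  obtain ⟨a, ha, hap⟩ := exists_pos_le_prob hR hD hc hgam htop j
  obtain ⟨t, ht0, ht1, ht⟩ := exists_mul_lam_update_le hR hD hgam hb j hc ha
  refine ⟨t, ht0, ht1, fun p hp hpb hpj => ?_⟩
  refine le_trans ?_ (ht.trans (hap p hp (hpj.trans_le ht1)))
  have hbt := update_mem_positivePrices hb j ht0
  -- Raising the other prices shrinks the denominator and so raises the j-th rate; λ_j is largest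
  -- with the others at `b`.
  refine mul_le_mul_of_nonneg_left (integral_mono_ae (integrable_rate hR hD hp j)
    (integrable_rate hR hD hbt j) ?_) ht0.le
  filter_upwards [hR] with θ hθ
  have h1 : p ≤ Function.update b j t := by
    rw [le_update_iff]
    exact ⟨hpj.le, fun k _ => hpb k⟩
  have h2 := hθ.denom_le_denom hp h1
  have h3 := m.psi_nonneg j θ t
  have h4 := m.expUtility_nonneg j θ t
  have h5 := m.denom_pos θ (Function.update b j t)
  simp only [rate, Function.update_self, hpj]
  gcongr

end

/-! ### Fixed points of the markup map and stationarity. -/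

/-- The markup map `ζ(p) = Ω̃(p) (p - c) - Λ(p)⁻¹ P(p)`. -/
noncomputable def zeta (m : MixedLogitMarket T J F) (p : Fin J → ℝ) (j : Fin J) : ℝ :=
  (∑ k with m.firm k = m.firm j, m.gam p k j * (p k - m.cost k) + m.prob p j) / m.lam p j

section

variable {m : MixedLogitMarket T J F} (hR : ∀ᵐ θ ∂m.μ, m.IsRegular θ) (hD : m.IsDominated)
  {c M : ℝ} (hc : c < 1)
  (hgam : ∀ p ∈ positivePrices J, ∀ j,
    ∑ k with m.firm k = m.firm j, m.gam p k j ≤ c * m.lam p j)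
  (hlam : ∀ p ∈ positivePrices J, ∀ j, 0 < m.lam p j)
  (hM : ∀ p ∈ positivePrices J, ∀ j, m.prob p j ≤ M * m.lam p j)

theorem prob_div_lam_le_zeta {p : Fin J → ℝ} (hpc : m.cost ≤ p) (j : Fin J) :
    m.prob p j / m.lam p j ≤ m.zeta p j := by
  unfold zeta
  have h1 := m.lam_nonneg p j
  have h2 : 0 ≤ ∑ k with m.firm k = m.firm j, m.gam p k j * (p k - m.cost k) :=
    Finset.sum_nonneg fun k _ => mul_nonneg (m.gam_nonneg p k j) (sub_nonneg.2 (hpc k))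
  gcongr
  linarith

include hgam hlam hM in
theorem zeta_le {p : Fin J → ℝ} (hp : p ∈ positivePrices J) {R : ℝ} (hR0 : 0 ≤ R)
    (hMR : M ≤ (1 - c) * R) (hpR : ∀ k, p k - m.cost k ≤ R) (j : Fin J) : m.zeta p j ≤ R := by
  unfold zeta
  rw [div_le_iff₀ (hlam p hp j)]
  have h1 : ∑ k with m.firm k = m.firm j, m.gam p k j * (p k - m.cost k)
      ≤ (∑ k with m.firm k = m.firm j, m.gam p k j) * R := by
    rw [Finset.sum_mul]
    exact Finset.sum_le_sum fun k _ =>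
      mul_le_mul_of_nonneg_left (hpR k) (m.gam_nonneg p k j)
  have h2 := mul_le_mul_of_nonneg_right (hgam p hp j) hR0
  have h3 := hM p hp j
  have h4 := mul_le_mul_of_nonneg_right hMR (hlam p hp j).le
  linarith

include hR hD hlam in
theorem continuousAt_zeta {p : Fin J → ℝ} (hp : p ∈ positivePrices J) :
    ContinuousAt m.zeta p := by
  refine continuousAt_pi.2 fun j => ContinuousAt.div (ContinuousAt.add ?_
    (continuousAt_prob hR hD hp j)) (continuousAt_lam hR hD hp j) (hlam p hp j).ne'
  exact tendsto_finsetSum _ fun k _ => (continuousAt_gam hR hD hp k j).mul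
    ((continuous_apply k).continuousAt.sub continuousAt_const)

include hR hD hc hgam hlam hM in
theorem exists_fixedPoint_zeta (htop : m.maxReservation = ⊤) :
    ∃ p ∈ positivePrices J, ∀ j, p j - m.cost j = m.zeta p j := by
  have hdiag : ∀ p ∈ positivePrices J, ∀ k, m.gam p k k ≤ c * m.lam p k := fun p hp k =>
    (Finset.single_le_sum (f := fun i => m.gam p i k) (fun i _ => m.gam_nonneg p i k)
      ((Finset.mem_filter (p := fun i => m.firm i = m.firm k)).2
        ⟨Finset.mem_univ k, rfl⟩)).trans (hgam p hp k)
  have hc0 : 0 < 1 - c := sub_pos.2 hc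
  -- M ≤ (1 - c) R makes the upper faces invariant; R ≥ 1 leaves room for lower bounds up to 1 when
  -- the cost is 0.
  let R : ℝ := max 1 (M / (1 - c))
  have hR1 : 1 ≤ R := le_max_left _ _
  have hR0 : 0 ≤ R := zero_le_one.trans hR1
  have hMR : M ≤ (1 - c) * R := by
    rw [← div_le_iff₀' hc0]; exact le_max_right _ _
  let b : Fin J → ℝ := fun j => m.cost j + R
  have hb : b ∈ positivePrices J := fun j => by
    have := m.cost_nonneg j
    simp only [b]; linarith
  -- A positive cost serves as its own lower bound; a zero cost is replaced by a small positive
  -- price, so that the box stays where ζ is continuous.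
  have hex : ∀ j, ∃ a, 0 < a ∧ m.cost j ≤ a ∧ a ≤ b j ∧ ∀ p ∈ positivePrices J, p ≤ b →
      p j = a → (a - m.cost j) * m.lam p j ≤ m.prob p j := by
    intro j
    rcases (m.cost_nonneg j).eq_or_lt with h | h
    · obtain ⟨t, ht0, ht1, ht⟩ := exists_mul_lam_le_prob hR hD hc hdiag htop hb j
      refine ⟨t, ht0, by rw [← h]; exact ht0.le, ?_, ?_⟩
      · simp only [b, ← h]; linarith
      · simpa only [← h, sub_zero] using ht
    · refine ⟨m.cost j, h, le_rfl, ?_, fun p _ _ _ => ?_⟩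
      · simp only [b]; linarith
      · rw [sub_self, zero_mul]; exact m.prob_nonneg p j
  choose a ha0 hca hab ha using hex
  have hmem : ∀ p ∈ Set.Icc a b, p ∈ positivePrices J := fun p hp j => (ha0 j).trans_le (hp.1 j)
  obtain ⟨p, hp, hfix⟩ := exists_fixedPoint_of_continuousOn_Icc (a := a) (b := b) hab
    (f := fun p j => max (a j) (m.cost j + m.zeta p j))
    (fun p hp => by
      refine ContinuousAt.continuousWithinAt (continuousAt_pi.2 fun j => ?_)
      exact continuousAt_const.max
        ((continuousAt_pi.1 (continuousAt_zeta hR hD hlam (hmem p hp)) j).const_add _))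
    (fun p hp => by
      refine ⟨fun j => le_max_left _ _, fun j => max_le (hab j) ?_⟩
      have := zeta_le hgam hlam hM (hmem p hp) hR0 hMR
        (fun k => sub_le_iff_le_add'.2 (hp.2 k)) j
      simp only [b]; linarith)
  refine ⟨p, hmem p hp, fun j => ?_⟩
  have hj : max (a j) (m.cost j + m.zeta p j) = p j := congrFun hfix j
  have hpc : m.cost ≤ p := fun k => (hca k).trans (hp.1 k)
  -- If the truncation is active, then p_j = a_j, and the choice of a_j gives a_j - c_j ≤ P_j/λ_j ≤
  -- ζ_j, so equality holds anyway.
  rcases le_total (a j) (m.cost j + m.zeta p j) with h | h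
  · rw [max_eq_right h] at hj; linarith
  · rw [max_eq_left h] at hj
    have h1 := ha j p (hmem p hp) hp.2 hj.symm
    rw [← le_div_iff₀ (hlam p (hmem p hp) j)] at h1
    have h2 := prob_div_lam_le_zeta hpc j
    linarith

include hR hD in
theorem intraJacobian_eq {p : Fin J → ℝ} (hp : p ∈ positivePrices J) :
    m.intraJacobian p = Matrix.of fun j k =>
      if m.firm j = m.firm k then m.gam p j k - if j = k then m.lam p k else 0 else 0 := by
  unfold intraJacobian
  congr 1
  ext j k
  refine if_congr Iff.rfl ?_ rfl
  have h := hasDerivAt_prob_update hR hD hp j k (hp k)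
  rw [Function.update_eq_self] at h
  exact h.deriv

include hR hD hc hgam hlam in
-- Strict column diagonal dominance: the off-diagonal sum is at most c λ_k - γ_{kk}, less than λ_k -
-- γ_{kk}.
theorem det_intraJacobian_ne_zero {p : Fin J → ℝ} (hp : p ∈ positivePrices J) :
    (m.intraJacobian p).det ≠ 0 := by
  rw [intraJacobian_eq hR hD hp]
  refine det_ne_zero_of_sum_col_lt_diag fun k => ?_
  have h1 : ∑ i ∈ Finset.univ.erase k, ‖(Matrix.of fun j k =>
      if m.firm j = m.firm k then m.gam p j k - if j = k then m.lam p k else 0 else 0) i k‖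
      = ∑ i ∈ Finset.univ.erase k, if m.firm i = m.firm k then m.gam p i k else 0 := by
    refine Finset.sum_congr rfl fun i hi => ?_
    rw [Matrix.of_apply, if_neg (Finset.ne_of_mem_erase hi), sub_zero]
    split_ifs
    · exact Real.norm_of_nonneg (m.gam_nonneg p i k)
    · exact norm_zero
  have h2 := hgam p hp k
  rw [Finset.sum_filter, ← Finset.add_sum_erase _ _ (Finset.mem_univ k), if_pos rfl] at h2
  have h3 := mul_lt_mul_of_pos_right hc (hlam p hp k)
  rw [h1, Matrix.of_apply, if_pos rfl, if_pos rfl, norm_sub_rev]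
  refine lt_of_lt_of_le ?_ (Real.le_norm_self _)
  linarith

include hR hD in
theorem transpose_intraJacobian_mulVec_apply {p : Fin J → ℝ} (hp : p ∈ positivePrices J)
    (x : Fin J → ℝ) (j : Fin J) : ((m.intraJacobian p)ᵀ *ᵥ x) j =
      ∑ k with m.firm k = m.firm j, m.gam p k j * x k - m.lam p j * x j := by
  rw [intraJacobian_eq hR hD hp, Matrix.mulVec_eq_sum, Finset.sum_apply, Finset.sum_filter]
  have : m.lam p j * x j = ∑ k, if k = j then m.lam p j * x k else 0 := by simp
  rw [this, ← Finset.sum_sub_distrib]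
  refine Finset.sum_congr rfl fun k _ => ?_
  by_cases hkj : k = j
  · simp [hkj]; ring
  · by_cases hf : m.firm k = m.firm j <;> simp [hkj, hf, mul_comm]

include hR hD in
theorem hasDerivAt_profit {p : Fin J → ℝ} (hp : p ∈ positivePrices J) (j : Fin J) :
    HasDerivAt (fun t => m.profit (m.firm j) (Function.update p j t))
      (((m.intraJacobian p)ᵀ *ᵥ (p - m.cost)) j + m.prob p j) (p j) := by
  have h := HasDerivAt.fun_sum (u := Finset.univ.filter fun k => m.firm k = m.firm j) fun k _ =>
    (hasDerivAt_prob_update hR hD hp k j (hp j)).mul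
      ((hasDerivAt_pi.1 (hasDerivAt_update p j (p j)) k).sub_const (m.cost k))
  refine h.congr_deriv ?_
  rw [transpose_intraJacobian_mulVec_apply hR hD hp]
  simp only [Function.update_eq_self, Pi.single_apply, Pi.sub_apply, sub_mul, ite_mul, zero_mul,
    mul_ite, mul_one, mul_zero, Finset.sum_add_distrib, Finset.sum_sub_distrib,
    Finset.sum_ite_eq', Finset.mem_filter, Finset.mem_univ, true_and, if_true]

include hR hD hc hgam hlam hM in
theorem exists_isSimultaneouslyStationary (htop : m.maxReservation = ⊤) :
    ∃ p : Fin J → ℝ, (∀ j, 0 < p j) ∧ m.IsSimultaneouslyStationary p ∧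
      IsUnit (m.intraJacobian p).det ∧ p = m.cost + m.eta p := by
  obtain ⟨p, hp, hfix⟩ := exists_fixedPoint_zeta hR hD hc hgam hlam hM htop
  have hdet : IsUnit (m.intraJacobian p).det :=
    (det_intraJacobian_ne_zero hR hD hc hgam hlam hp).isUnit
  have heq : (m.intraJacobian p)ᵀ *ᵥ (p - m.cost) = -m.prob p := by
    ext j
    rw [transpose_intraJacobian_mulVec_apply hR hD hp]
    have h := hfix j
    rw [zeta, eq_div_iff (hlam p hp j).ne'] at h
    simp only [Pi.sub_apply, Pi.neg_apply]
    linarith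
  refine ⟨p, hp, ⟨differentiableAt_pi.2 fun j => (hasFDerivAt_prob hR hD hp j).differentiableAt,
    fun j => ?_⟩, hdet, ?_⟩
  · have h := hasDerivAt_profit hR hD hp j
    rwa [heq, Pi.neg_apply, neg_add_cancel] at h
  · have hdet' : IsUnit (m.intraJacobian p)ᵀ.det := by rwa [Matrix.det_transpose]
    have h : m.prob p = -((m.intraJacobian p)ᵀ *ᵥ (p - m.cost)) := by rw [heq, neg_neg]
    rw [eta, h, Matrix.mulVec_neg, neg_neg, Matrix.mulVec_mulVec,
      Matrix.nonsing_inv_mul _ hdet', Matrix.one_mulVec, add_sub_cancel]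

end

end MixedLogitMarket

theorem mainTheorem1 {T : Type*} [MeasurableSpace T] {J F : ℕ} (m : MixedLogitMarket T J F)
    (hU : m.UtilityAssumption) (hL : m.LeibnizAssumption) (hB : m.BoundedAssumption) :
    ∃ p : Fin J → ℝ, (∀ j, 0 < p j) ∧ m.IsSimultaneouslyStationary p ∧
      IsUnit (m.intraJacobian p).det ∧ p = m.cost + m.eta p := by
  have htop := hB.maxReservation_eq_top
  have hR := MixedLogitMarket.ae_isRegular hU hL htop
  have hD := MixedLogitMarket.isDominated hR hL htop
  obtain ⟨M, hM0, hM⟩ := hB.exists_bound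
  obtain ⟨ε, hε0, -, hε⟩ := hB.exists_isLUB
  have hle : ∀ p ∈ MixedLogitMarket.positivePrices J, ∀ j, m.prob p j ≤ M * m.lam p j :=
    fun p hp j => MixedLogitMarket.prob_le_mul_lam hR hD htop hM hp j
  have hlam : ∀ p ∈ MixedLogitMarket.positivePrices J, ∀ j, 0 < m.lam p j := fun p hp j =>
    pos_of_mul_pos_right ((MixedLogitMarket.prob_pos hR hp htop j).trans_le (hle p hp j)) hM0.le
  exact MixedLogitMarket.exists_isSimultaneouslyStationary hR hD (sub_lt_self 1 hε0)
    (fun p hp j => MixedLogitMarket.sum_gam_le hR hp (hlam p hp)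
      (hε.1 (Set.mem_image_of_mem _ hp)) j) hlam hle htop
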